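/- Let $D=\{x\in\mathbb R^3:\ x_1^2+x_2^2\le 1,\ 0\le x_3\le 1\}$, let $T>0$, and write $L^q_tL^p_x=L^q(0,T;L^p(D))$. Let $0\le\alpha<1$, $1\le p<\infty$, $1\le q\le\infty$ satisfy $$[(3-\alpha)p-2]\,q<2 .$$ Then there exist a force $f\in L^q_tL^p_x$ and an initial velocity $v_0$ such that the Navier–Stokes problem $$\Delta v-v\cdot\nabla v-\nabla P-\partial_t v=f,\qquad \nabla\cdot v=0\quad\text{in } D\times[0,T),\qquad v(\cdot,0)=v_0,$$ with the no-slip condition $v=0$ on the vertical boundary $\{x_1^2+x_2^2=1\}$ of $D$ and the Navier total slip condition $v_3=0$, $\partial_3v_1=\partial_3v_2=0$ on the horizontal boundary $\{x_3\in\{0,1\}\}$ of $D$, has a classical solution $v$, unique among classical solutions (velocity $C^1$ in $(x,t)$ on $D\times[0,T)$ and $C^2$ in $x$ at each time, pressure $C^1$ in $x$ at each time, all up to the boundary of $D$), with the following properties: * $f$ and $v$ are $C^\infty$ on $D\times[0,T)$ (up to the boundary of $D$); * $v\in L^\infty_tL^2_x\cap L^2_tH^1_x$; * $\lim_{t\to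 T^-}\|v(\cdot,t)\|_{L^\infty(D)}=+\infty$, and blow up occurs only at time $T$: $v$ is bounded on $D\times[0,t_1]$ for every $t_1<T$; * $v\in L^{\tilde q}_tL^{\tilde p}_x$ for all $1\le\tilde p<\infty$, $1\le\tilde q\le\infty$ with $[(1-\alpha)\tilde p-2]\,\tilde q<2$ (for $\tilde q=\infty$ this is read as $(1-\alpha)\tilde p\le 2$). -/

import Mathlib

open MeasureTheory Set Filter Topology
open scoped ENNReal ContDiff

noncomputable section

/-- Three-dimensional Euclidean space. -/
abbrev E3 : Type := EuclideanSpace ℝ (Fin 3)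

/-- The `i`-th vector of the standard basis of `ℝ³` (indices `0, 1, 2`). -/
def stdVec (i : Fin 3) : E3 := EuclideanSpace.single i 1

/-- The (closed) cylinder `D = B₂(0,1) × [0,1]`: closed unit disc times the unit interval. -/
def cylD : Set E3 := {x | x 0 ^ 2 + x 1 ^ 2 ≤ 1 ∧ 0 ≤ x 2 ∧ x 2 ≤ 1}

/-- The vertical (lateral) part of the boundary of `D`. -/
def verticalBdry : Set E3 := {x | x ∈ cylD ∧ x 0 ^ 2 + x 1 ^ 2 = 1}

/-- The horizontal part (bottom and top) of the boundary of `D`. -/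
def horizontalBdry : Set E3 := {x | x ∈ cylD ∧ (x 2 = 0 ∨ x 2 = 1)}

/-- Partial derivative `∂ᵢ v` on the closed cylinder (one-sided at the boundary). -/
def pderivD (i : Fin 3) (v : E3 → E3) (x : E3) : E3 :=
  fderivWithin ℝ v cylD x (stdVec i)

/-- Divergence on the closed cylinder. -/
def divD (v : E3 → E3) (x : E3) : ℝ := ∑ i : Fin 3, pderivD i v x i

/-- The convective term `(v · ∇) v = ∑ᵢ vᵢ ∂ᵢ v`. -/
def convD (v : E3 → E3) (x : E3) : E3 := ∑ i : Fin 3, v x i • pderivD i v x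

/-- `(v, P)` is a classical solution of the Navier-Stokes system with force `f` and initial
velocity `v₀` in `D × [0,T)`, with the no-slip condition on the vertical boundary and the Navier
total slip condition on the horizontal boundary. Fields are written `v t x`. -/
structure IsClassicalNSSolution (T : ℝ) (f : ℝ → E3 → E3) (v₀ : E3 → E3)
    (v : ℝ → E3 → E3) (P : ℝ → E3 → ℝ) : Prop where
  /-- The velocity is `C¹` in `(t, x)`, up to the boundary of `D` and up to `t = 0`. -/
  velocity_C1 : ContDiffOn ℝ 1 (fun z : ℝ × E3 => v z.1 z.2) (Ico 0 T ×ˢ cylD)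
  /-- The velocity is `C²` in `x` at every time. -/
  velocity_C2 : ∀ t ∈ Ico 0 T, ContDiffOn ℝ 2 (v t) cylD
  /-- The pressure is `C¹` in `x` at every time. -/
  pressure_C1 : ∀ t ∈ Ico 0 T, ContDiffOn ℝ 1 (P t) cylD
  /-- `Δv - v·∇v - ∇P - ∂ₜv = f`. -/
  momentum : ∀ t ∈ Ico 0 T, ∀ x ∈ cylD,
    InnerProductSpace.laplacianWithin (v t) cylD x - convD (v t) x
      - gradientWithin (P t) cylD x - derivWithin (fun s => v s x) (Ico 0 T) t = f t x
  /-- `∇·v = 0`. -/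
  incompressible : ∀ t ∈ Ico 0 T, ∀ x ∈ cylD, divD (v t) x = 0
  /-- `v(x,0) = v₀(x)`. -/
  initial : ∀ x ∈ cylD, v 0 x = v₀ x
  /-- No slip on the vertical boundary. -/
  noSlip : ∀ t ∈ Ico 0 T, ∀ x ∈ verticalBdry, v t x = 0
  /-- Navier total slip on the horizontal boundary: `v₃ = 0` and `∂₃v₁ = ∂₃v₂ = 0`. -/
  totalSlip : ∀ t ∈ Ico 0 T, ∀ x ∈ horizontalBdry,
    v t x 2 = 0 ∧ pderivD 2 (v t) x 0 = 0 ∧ pderivD 2 (v t) x 1 = 0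

/-- `g ∈ L^q(0,T; L^p(D))`. -/
def MemLqLp {F : Type*} [NormedAddCommGroup F] (T : ℝ) (q p : ℝ≥0∞) (g : ℝ → E3 → F) : Prop :=
  AEStronglyMeasurable (fun z : ℝ × E3 => g z.1 z.2)
      ((volume.restrict (Ioo 0 T)).prod (volume.restrict cylD)) ∧
    eLpNorm (fun t => eLpNorm (g t) p (volume.restrict cylD)) q (volume.restrict (Ioo 0 T)) < ⊤

/-- `g` is smooth (`C^∞`) on `D × [0,T)`, up to the boundary of `D` and up to `t = 0`. -/
def SmoothOnCyl (T : ℝ) (g : ℝ → E3 → E3) : Prop :=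
  ContDiffOn ℝ ∞ (fun z : ℝ × E3 => g z.1 z.2) (Ico 0 T ×ˢ cylD)

/-- The constraint `[c p - 2] q < 2` with `1 ≤ p < ∞`, `1 ≤ q ≤ ∞`, read in the extended reals
(so that for `q = ∞` it says `c p ≤ 2`). -/
def ExponentConstraint (c : ℝ) (p : ℝ) (q : ℝ≥0∞) : Prop :=
  ((c * p - 2 : ℝ) : EReal) * (q : EReal) < 2

end

/-! The solution is an explicit swirl `φ(t, r²) • (-x₁, x₀, 0)` with `r² = x₀² + x₁²` and `φ = (1 -
s) (s + T - t)^(-k)`. Any such field is divergence free, is independent of the vertical coordinate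
(so the slip conditions hold) and vanishes at `r = 1`. Its convective term is the centripetal field
`-φ² (x₀, x₁, 0)`, a gradient, which the pressure absorbs. The force is then simply `Δv - ∂ₜv`.

Put `U = r² + T - t`. Then `v`, `∇v` and `f` are bounded by constant multiples of `U^(-(k-1/2))`,
`U^(-k)` and `U^(-(k+1/2))`, and `|v|` really has size `(T-t)^(-(k-1/2))` at `r² = T - t`, so it
blows up once `k > 1/2`. By `memLqLp_of_norm_le_rpow`, `U^(-b)` lies in `L^q_t L^p_x` when `b < 1/p
+ 1/q`. With `k = 1/2 + (1-α)/4` every required integrability reduces to this inequality.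

Uniqueness (`IsClassicalNSSolution.unique`) is the energy method: the difference of two solutions
satisfies `E' ≤ 2K E` with `E = 0` initially. Integration by parts rests on a divergence theorem for
the cylinder, proved by slicing along coordinate lines. -/

/-! ### Geometry of the cylinder. -/

theorem isClosed_cylD : IsClosed cylD := by
  have h : cylD = {x : E3 | x 0 ^ 2 + x 1 ^ 2 ≤ 1} ∩ ({x | 0 ≤ x 2} ∩ {x | x 2 ≤ 1}) := by
    ext x; simp [cylD]
  rw [h]
  refine IsClosed.inter ?_ (IsClosed.inter ?_ ?_) <;>
    exact isClosed_le (by fun_prop) (by fun_prop)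

theorem measurableSet_cylD : MeasurableSet cylD := isClosed_cylD.measurableSet

theorem isCompact_cylD : IsCompact cylD := by
  refine Metric.isCompact_of_isClosed_isBounded isClosed_cylD ?_
  refine (Metric.isBounded_closedBall (x := (0 : E3)) (r := 2)).subset fun x hx => ?_
  rw [mem_closedBall_zero_iff, EuclideanSpace.norm_eq, Real.sqrt_le_left (by norm_num)]
  obtain ⟨h1, h2, h3⟩ := hx
  simp only [Fin.sum_univ_three, Real.norm_eq_abs, sq_abs]
  nlinarith

theorem convex_cylD : Convex ℝ cylD := by
  intro x hx y hy a b ha hb hab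
  obtain ⟨h1, h2, h3⟩ := hx
  obtain ⟨k1, k2, k3⟩ := hy
  refine ⟨?_, ?_, ?_⟩
  · simp only [PiLp.add_apply, PiLp.smul_apply, smul_eq_mul]
    have : x 0 * y 0 + x 1 * y 1 ≤ 1 := by
      nlinarith [sq_nonneg (x 0 - y 0), sq_nonneg (x 1 - y 1)]
    have e : (a * x 0 + b * y 0) ^ 2 + (a * x 1 + b * y 1) ^ 2 =
      a ^ 2 * (x 0 ^ 2 + x 1 ^ 2) + 2 * (a * b) * (x 0 * y 0 + x 1 * y 1)
        + b ^ 2 * (y 0 ^ 2 + y 1 ^ 2) := by ring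
    have e2 : 1 = a ^ 2 * 1 + 2 * (a * b) * 1 + b ^ 2 * 1 := by
      have : (a + b) ^ 2 = 1 := by rw [hab]; norm_num
      linarith
    rw [e, e2]
    gcongr
  · simp only [PiLp.add_apply, PiLp.smul_apply, smul_eq_mul]; positivity
  · simp only [PiLp.add_apply, PiLp.smul_apply, smul_eq_mul]; nlinarith

theorem interior_cylD_nonempty : (interior cylD).Nonempty := by
  have hop : IsOpen ({x : E3 | x 0 ^ 2 + x 1 ^ 2 < 1} ∩ ({x | 0 < x 2} ∩ {x | x 2 < 1})) := by
    refine IsOpen.inter ?_ (IsOpen.inter ?_ ?_) <;>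
      exact isOpen_lt (by fun_prop) (by fun_prop)
  refine ⟨(1 / 2 : ℝ) • stdVec 2, interior_maximal ?_ hop ?_⟩
  · rintro x ⟨h1, h2, h3⟩
    exact ⟨h1.le, h2.le, h3.le⟩
  · simp [stdVec]; norm_num

theorem uniqueDiffOn_cylD : UniqueDiffOn ℝ cylD :=
  uniqueDiffOn_convex convex_cylD interior_cylD_nonempty

/-- This lets almost everywhere identities between continuous functions on the cylinder be upgraded
to every point, boundary included. -/
theorem cylD_subset_closure_interior : cylD ⊆ closure (interior cylD) := by
  rw [convex_cylD.closure_interior_eq_closure_of_nonempty_interior interior_cylD_nonempty]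
  exact subset_closure

theorem volume_cylD_lt_top : volume cylD < ⊤ := isCompact_cylD.measure_lt_top

instance : IsFiniteMeasure (volume.restrict cylD) :=
  ⟨by simpa using volume_cylD_lt_top⟩

/-! ### Divergence theorem on the cylinder. -/

/-- A function on a symmetric interval vanishing at both ends has derivative of mean zero. -/
theorem setIntegral_Icc_deriv_eq_zero {a b : ℝ} {g g' : ℝ → ℝ}
    (hg : ∀ y ∈ Icc a b, HasDerivWithinAt g (g' y) (Icc a b) y)
    (hg' : ContinuousOn g' (Icc a b)) (ha : a ≤ b → g a = 0) (hb : a ≤ b → g b = 0) :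
    ∫ y in Icc a b, g' y = 0 := by
  rcases lt_or_ge b a with hab | hab
  · simp [Icc_eq_empty (not_le.2 hab)]
  rw [integral_Icc_eq_integral_Ioc, ← intervalIntegral.integral_of_le hab,
    intervalIntegral.integral_eq_sub_of_hasDerivAt_of_le hab
      (fun y hy => (hg y hy).continuousWithinAt)
      (fun y hy => (hg y (Ioo_subset_Icc_self hy)).hasDerivAt (Icc_mem_nhds hy.1 hy.2)),
    ha hab, hb hab, sub_zero]
  exact (hg'.mono (by rw [uIcc_of_le hab])).intervalIntegrable

/-- Integration over `ℝ³` slice by slice in the `i`-th direction. -/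
theorem integral_eq_zero_of_slices (i : Fin 3) (G : E3 → ℝ) (hG : Integrable G)
    (h : ∀ x : E3, ∫ y : ℝ, G (x + (y - x i) • stdVec i) = 0) : ∫ x, G x = 0 := by
  have e1 := (EuclideanSpace.volume_preserving_symm_measurableEquiv_toLp (Fin 3)).symm
  have e2 := (volume_preserving_piFinSuccAbove (fun _ : Fin 3 => ℝ) i).symm
  have e := e1.comp e2
  have hme : MeasurableEmbedding (⇑(MeasurableEquiv.toLp 2 (Fin 3 → ℝ)).symm.symm ∘
      ⇑(MeasurableEquiv.piFinSuccAbove (fun _ : Fin 3 => ℝ) i).symm) := by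
    exact (MeasurableEquiv.measurableEmbedding _).comp (MeasurableEquiv.measurableEmbedding _)
  rw [← e.integral_comp hme, Measure.volume_eq_prod, integral_prod_symm]
  · have : ∀ z : Fin 2 → ℝ, ∫ y : ℝ, G ((⇑(MeasurableEquiv.toLp 2 (Fin 3 → ℝ)).symm.symm ∘
      ⇑(MeasurableEquiv.piFinSuccAbove (fun _ : Fin 3 => ℝ) i).symm) (y, z)) = 0 := by
      intro z
      -- The `i`-th coordinate of the base point does not affect the line through it, so `0` serves.
      rw [← h (WithLp.toLp 2 (i.insertNth 0 z))]
      congr 1; ext y; congr 1; ext j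
      refine Fin.succAboveCases i ?_ (fun j => ?_) j
      · simp [stdVec, MeasurableEquiv.piFinSuccAbove, Fin.insertNthEquiv]
      · simp [stdVec, MeasurableEquiv.piFinSuccAbove, Fin.insertNthEquiv]
    simp only [this]; simp
  · exact (e.integrable_comp_emb hme).2 hG

theorem line_apply_same (x : E3) (i : Fin 3) (y : ℝ) : (x + (y - x i) • stdVec i) i = y := by
  simp [stdVec]

theorem line_apply_ne (x : E3) {i j : Fin 3} (h : j ≠ i) (y : ℝ) :
    (x + (y - x i) • stdVec i) j = x j := by
  simp [stdVec, h]

/-- The cylinder meets a coordinate line in a closed interval, with end points on the boundary. -/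
theorem exists_slice_cylD (i : Fin 3) (x : E3) : ∃ a b : ℝ,
    (∀ y, x + (y - x i) • stdVec i ∈ cylD ↔ y ∈ Icc a b) ∧
    (a ≤ b → ∀ y, y = a ∨ y = b →
      (i ≠ 2 → x + (y - x i) • stdVec i ∈ verticalBdry) ∧
      (i = 2 → x + (y - x i) • stdVec i ∈ horizontalBdry)) := by
  have main : ∀ i j : Fin 3, i ≠ 2 → (∀ z : E3, z 0 ^ 2 + z 1 ^ 2 = z i ^ 2 + z j ^ 2) → j ≠ i →
      ∃ a b : ℝ, (∀ y, x + (y - x i) • stdVec i ∈ cylD ↔ y ∈ Icc a b) ∧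
        (a ≤ b → ∀ y, y = a ∨ y = b → x + (y - x i) • stdVec i ∈ verticalBdry) := by
    intro i j hi hij hji
    by_cases hx : (0 ≤ x 2 ∧ x 2 ≤ 1) ∧ 0 ≤ 1 - x j ^ 2
    · have key : ∀ y, x + (y - x i) • stdVec i ∈ cylD ↔
          y ∈ Icc (-√(1 - x j ^ 2)) (√(1 - x j ^ 2)) := by
        intro y
        rw [cylD, mem_ofPred_eq, hij, line_apply_same, line_apply_ne x hji,
          line_apply_ne x (Ne.symm hi), mem_Icc, ← abs_le, ← Real.sqrt_sq_eq_abs,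
          Real.sqrt_le_sqrt_iff hx.2]
        simp only [hx.1, and_self, and_true]
        constructor <;> intro h <;> linarith
      refine ⟨_, _, key, fun hab y hy => ⟨(key y).2 ?_, ?_⟩⟩
      · rcases hy with rfl | rfl
        · exact left_mem_Icc.2 hab
        · exact right_mem_Icc.2 hab
      · rw [hij, line_apply_same, line_apply_ne x hji]
        rcases hy with rfl | rfl <;> simp [Real.sq_sqrt hx.2]
    -- The line misses the cylinder; `[1, 0]` encodes the empty interval.
    · refine ⟨1, 0, fun y => ⟨fun h => (hx ?_).elim, fun h => by
        have := h.1.trans h.2; norm_num at this⟩, fun h => by norm_num at h⟩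
      rw [cylD, mem_ofPred_eq, hij, line_apply_same, line_apply_ne x hji,
          line_apply_ne x (Ne.symm hi)] at h
      exact ⟨h.2, by nlinarith [h.1]⟩
  by_cases hi : i = 2
  · subst hi
    by_cases hx : x 0 ^ 2 + x 1 ^ 2 ≤ 1
    · have key : ∀ y, x + (y - x 2) • stdVec 2 ∈ cylD ↔ y ∈ Icc (0 : ℝ) 1 := by
        intro y
        rw [cylD, mem_ofPred_eq, line_apply_same, line_apply_ne x (by decide),
          line_apply_ne x (by decide)]
        simp [hx]
      refine ⟨0, 1, key, fun hab y hy => ⟨fun h => (h rfl).elim, fun _ => ⟨(key y).2 ?_, ?_⟩⟩⟩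
      · rcases hy with rfl | rfl <;> simp
      · rwa [line_apply_same]
    · refine ⟨1, 0, fun y => ⟨fun h => (hx ?_).elim, fun h => by
        have := h.1.trans h.2; norm_num at this⟩, fun h => by norm_num at h⟩
      rw [cylD, mem_ofPred_eq, line_apply_same, line_apply_ne x (by decide),
          line_apply_ne x (by decide)] at h
      exact h.1
  · have : ∃ j : Fin 3, (∀ z : E3, z 0 ^ 2 + z 1 ^ 2 = z i ^ 2 + z j ^ 2) ∧ j ≠ i := by
      fin_cases i
      · exact ⟨1, fun z => rfl, by decide⟩
      · exact ⟨0, fun z => add_comm _ _, by decide⟩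
      · exact (hi rfl).elim
    obtain ⟨j, hij, hji⟩ := this
    obtain ⟨a, b, h1, h2⟩ := main i j hi hij hji
    exact ⟨a, b, h1, fun hab y hy => ⟨fun _ => h2 hab y hy, fun h => (hi h).elim⟩⟩

/-- The divergence theorem on the cylinder, one component at a time. -/
theorem setIntegral_cylD_fderivWithin_eq_zero (i : Fin 3) {g : E3 → ℝ}
    (hg : ContDiffOn ℝ 1 g cylD) (hv : i ≠ 2 → ∀ x ∈ verticalBdry, g x = 0)
    (hh : i = 2 → ∀ x ∈ horizontalBdry, g x = 0) :
    ∫ x in cylD, fderivWithin ℝ g cylD x (stdVec i) = 0 := by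
  have hc : ContinuousOn (fun x => fderivWithin ℝ g cylD x (stdVec i)) cylD :=
    (hg.continuousOn_fderivWithin uniqueDiffOn_cylD le_rfl).clm_apply continuousOn_const
  rw [← integral_indicator measurableSet_cylD]
  refine integral_eq_zero_of_slices i _
    ((integrable_indicator_iff measurableSet_cylD).2 (hc.integrableOn_compact isCompact_cylD)) ?_
  intro x
  obtain ⟨a, b, h1, h2⟩ := exists_slice_cylD i x
  have hl : ∀ y, HasDerivAt (fun y : ℝ => x + (y - x i) • stdVec i) (stdVec i) y := by
    intro y
    simpa using (((hasDerivAt_id y).sub_const (x i)).smul_const (stdVec i)).const_add x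
  have hm : MapsTo (fun y : ℝ => x + (y - x i) • stdVec i) (Icc a b) cylD :=
    fun y hy => (h1 y).2 hy
  have e : (fun y : ℝ => cylD.indicator (fun x => fderivWithin ℝ g cylD x (stdVec i))
      (x + (y - x i) • stdVec i)) = (Icc a b).indicator (fun y =>
        fderivWithin ℝ g cylD (x + (y - x i) • stdVec i) (stdVec i)) := by
    ext y
    by_cases hy : y ∈ Icc a b
    · rw [indicator_of_mem hy, indicator_of_mem ((h1 y).2 hy)]
    · rw [indicator_of_notMem hy, indicator_of_notMem (fun h => hy ((h1 y).1 h))]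
  rw [e, integral_indicator measurableSet_Icc]
  have hend : a ≤ b → ∀ y, y = a ∨ y = b → g (x + (y - x i) • stdVec i) = 0 := by
    intro hab y hy
    by_cases hi : i = 2
    · exact hh hi _ ((h2 hab y hy).2 hi)
    · exact hv hi _ ((h2 hab y hy).1 hi)
  refine setIntegral_Icc_deriv_eq_zero (g := fun y => g (x + (y - x i) • stdVec i))
    (fun y hy => ?_) ?_ (fun hab => hend hab a (Or.inl rfl)) (fun hab => hend hab b (Or.inr rfl))
  · exact ((hg.differentiableOn one_ne_zero _ (hm hy)).hasFDerivWithinAt).comp_hasDerivWithinAt y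
      (hl y).hasDerivWithinAt hm
  · exact hc.comp (fun y _ => (hl y).continuousAt.continuousWithinAt) hm

/-! ### Differential operators in coordinates and the energy inequality. -/

theorem sum_smul_stdVec (y : E3) : ∑ i, y i • stdVec i = y := by
  ext j
  fin_cases j <;> simp [Fin.sum_univ_three, stdVec]

theorem sum_smul_pderivD (v : E3 → E3) (x y : E3) :
    ∑ i, y i • pderivD i v x = fderivWithin ℝ v cylD x y := by
  conv_rhs => rw [← sum_smul_stdVec y]
  simp [pderivD]

theorem convD_eq (v : E3 → E3) (x : E3) : convD v x = fderivWithin ℝ v cylD x (v x) :=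
  sum_smul_pderivD v x (v x)

theorem pderivD_apply {v : E3 → E3} {x : E3} (hx : x ∈ cylD)
    (hv : DifferentiableWithinAt ℝ v cylD x) (i j : Fin 3) :
    pderivD i v x j = fderivWithin ℝ (fun z => v z j) cylD x (stdVec i) := by
  have h := ((EuclideanSpace.proj j : E3 →L[ℝ] ℝ).hasFDerivAt).comp_hasFDerivWithinAt x
    hv.hasFDerivWithinAt
  have h2 := h.fderivWithin (uniqueDiffOn_cylD x hx)
  have : (fun z => v z j) = ⇑(EuclideanSpace.proj j : E3 →L[ℝ] ℝ) ∘ v := rfl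
  rw [this, h2]
  rfl

theorem contDiffOn_pderivD {n : WithTop ℕ∞} {v : E3 → E3} (hv : ContDiffOn ℝ (n + 1) v cylD)
    (i : Fin 3) : ContDiffOn ℝ n (pderivD i v) cylD :=
  (hv.fderivWithin uniqueDiffOn_cylD le_rfl).clm_apply contDiffOn_const

theorem laplacianWithin_cylD_eq {v : E3 → E3} (hv : ContDiffOn ℝ 2 v cylD) {x : E3}
    (hx : x ∈ cylD) :
    InnerProductSpace.laplacianWithin v cylD x = ∑ i, pderivD i (pderivD i v) x := by
  rw [InnerProductSpace.laplacianWithin_eq_iteratedFDerivWithin_orthonormalBasis v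
    uniqueDiffOn_cylD hx (EuclideanSpace.basisFun (Fin 3) ℝ)]
  refine Finset.sum_congr rfl fun i _ => ?_
  have hd : DifferentiableWithinAt ℝ (fderivWithin ℝ v cylD) cylD x :=
    (hv.fderivWithin (m := 1) uniqueDiffOn_cylD (by norm_num)).differentiableOn one_ne_zero x hx
  rw [iteratedFDerivWithin_two_apply _ uniqueDiffOn_cylD hx]
  have h := hd.hasFDerivWithinAt.clm_apply (hasFDerivWithinAt_const (stdVec i) x cylD)
  unfold pderivD
  rw [h.fderivWithin (uniqueDiffOn_cylD x hx)]
  simp [stdVec]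

theorem gradientWithin_apply (P : E3 → ℝ) (x : E3) (i : Fin 3) :
    gradientWithin P cylD x i = fderivWithin ℝ P cylD x (stdVec i) := by
  rw [← inner_gradientWithin_left]
  rw [stdVec, EuclideanSpace.inner_single_right]; simp

/-- The energy inequality for the linearized equation at a fixed time. -/
theorem integral_inner_laplacian_sub_transport_le {w u : E3 → E3} {π : E3 → ℝ}
    (hw : ContDiffOn ℝ 2 w cylD) (hu : ContDiffOn ℝ 1 u cylD) (hπ : ContDiffOn ℝ 1 π cylD)
    (divw : ∀ x ∈ cylD, divD w x = 0) (divu : ∀ x ∈ cylD, divD u x = 0)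
    (hwv : ∀ x ∈ verticalBdry, w x = 0)
    (hwh : ∀ x ∈ horizontalBdry, w x 2 = 0 ∧ pderivD 2 w x 0 = 0 ∧ pderivD 2 w x 1 = 0)
    (huh : ∀ x ∈ horizontalBdry, u x 2 = 0) :
    ∫ x in cylD, inner ℝ (w x) (InnerProductSpace.laplacianWithin w cylD x
      - fderivWithin ℝ w cylD x (u x) - gradientWithin π cylD x) ≤ 0 := by
  have hw1 : ContDiffOn ℝ 1 w cylD := hw.of_le (by norm_num)
  have hpw : ∀ i, ContDiffOn ℝ 1 (pderivD i w) cylD :=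
    fun i => contDiffOn_pderivD (n := 1) (by simpa [one_add_one_eq_two] using hw) i
  have comp : ∀ {n : WithTop ℕ∞} {z : E3 → E3}, ContDiffOn ℝ n z cylD → ∀ j,
      ContDiffOn ℝ n (fun x => z x j) cylD := fun hz j =>
    (EuclideanSpace.proj j : E3 →L[ℝ] ℝ).contDiff.comp_contDiffOn hz
  -- The energy flux. Its divergence is the integrand of the goal plus `|∇w|²`, up to terms
  -- containing `div w` or `div u`. On the lateral wall every component vanishes with `w`; on the
  -- horizontal faces the vertical component vanishes because each product in it has a zero factor.
  let F : Fin 3 → E3 → ℝ := fun i x => ∑ j, w x j * pderivD i w x j - π x * w x i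
    - (1 / 2) * (∑ j, w x j * w x j) * u x i
  have hF : ∀ i, ContDiffOn ℝ 1 (F i) cylD := fun i =>
    ((ContDiffOn.sum fun j _ => (comp hw1 j).mul (comp (hpw i) j)).sub
      (hπ.mul (comp hw1 i))).sub ((contDiffOn_const.mul
        (ContDiffOn.sum fun j _ => (comp hw1 j).mul (comp hw1 j))).mul (comp hu i))
  have hint : ∀ i, ∫ x in cylD, fderivWithin ℝ (F i) cylD x (stdVec i) = 0 := by
    intro i
    refine setIntegral_cylD_fderivWithin_eq_zero i (hF i) (fun _ x hx => ?_) (fun hi x hx => ?_)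
    · simp [F, hwv x hx]
    · subst hi
      simp [F, Fin.sum_univ_three, hwh x hx, huh x hx]
  have hcF : ∀ i, ContinuousOn (fun x => fderivWithin ℝ (F i) cylD x (stdVec i)) cylD := fun i =>
    ((hF i).continuousOn_fderivWithin uniqueDiffOn_cylD le_rfl).clm_apply continuousOn_const
  have hsum : ∫ x in cylD, ∑ i, fderivWithin ℝ (F i) cylD x (stdVec i) = 0 := by
    rw [integral_finsetSum _ fun i _ => (hcF i).integrableOn_compact isCompact_cylD]
    simp [hint]
  have hd : ∀ {z : E3 → ℝ}, ContDiffOn ℝ 1 z cylD → ∀ x ∈ cylD,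
      HasFDerivWithinAt z (fderivWithin ℝ z cylD x) cylD x := fun hz x hx =>
    (hz.differentiableOn one_ne_zero x hx).hasFDerivWithinAt
  have hderiv : ∀ i, ∀ x ∈ cylD, fderivWithin ℝ (F i) cylD x (stdVec i) =
      ∑ j, (w x j * pderivD i (pderivD i w) x j + pderivD i w x j * pderivD i w x j)
        - (π x * pderivD i w x i + w x i * gradientWithin π cylD x i)
        - (1 / 2 * (∑ j, w x j * w x j) * pderivD i u x i
          + u x i * ∑ j, w x j * pderivD i w x j) := by
    intro i x hx
    have h1 := fun j => hd (comp hw1 j) x hx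
    have h2 := fun j => hd (comp (hpw i) j) x hx
    have h3 := hd hπ x hx
    have h4 := hd (comp hu i) x hx
    have h := ((HasFDerivWithinAt.fun_sum (u := Finset.univ) fun j _ => (h1 j).mul (h2 j)).sub
      (h3.mul (h1 i))).sub (((HasFDerivWithinAt.fun_sum (u := Finset.univ)
        fun j _ => (h1 j).mul (h1 j)).const_mul (1 / 2)).mul h4)
    have h' := h.fderivWithin (uniqueDiffOn_cylD x hx)
    have h'' : fderivWithin ℝ (F i) cylD x = _ := h'
    rw [h'']
    have q1 := fun j => pderivD_apply hx (hw1.differentiableOn one_ne_zero x hx) i j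
    have q2 := fun j => pderivD_apply hx ((hpw i).differentiableOn one_ne_zero x hx) i j
    have q3 := pderivD_apply hx (hu.differentiableOn one_ne_zero x hx) i i
    simp only [gradientWithin_apply]
    simp only [q2, q3]
    simp only [sub_apply, add_apply, Pi.mul_apply,
      smul_apply, smul_eq_mul, q1,
      Fin.sum_univ_three]
    ring
  rw [← hsum]
  have hlap : ∀ x ∈ cylD, InnerProductSpace.laplacianWithin w cylD x
      = ∑ i, pderivD i (pderivD i w) x := fun x hx => laplacianWithin_cylD_eq hw hx
  refine setIntegral_mono_on ?_ ?_ measurableSet_cylD ?_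
  · refine ContinuousOn.integrableOn_compact isCompact_cylD ?_
    refine hw.continuousOn.inner ((ContinuousOn.sub ?_ ?_).sub ?_)
    · refine ContinuousOn.congr ?_ hlap
      refine continuousOn_finsetSum _ fun i _ => ?_
      exact (contDiffOn_pderivD (n := 0) (by simpa using hpw i) i).continuousOn
    · exact (hw.continuousOn_fderivWithin uniqueDiffOn_cylD (by norm_num)).clm_apply hu.continuousOn
    · exact (LinearIsometryEquiv.continuous _).comp_continuousOn
        (hπ.continuousOn_fderivWithin uniqueDiffOn_cylD le_rfl)
  · exact (continuousOn_finsetSum _ fun i _ => hcF i).integrableOn_compact isCompact_cylD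
  · intro x hx
    have e1 := divw x hx
    have e2 := divu x hx
    rw [hlap x hx, ← sum_smul_pderivD]
    simp only [divD, Fin.sum_univ_three] at e1 e2
    simp only [hderiv _ x hx, PiLp.inner_apply, Fin.sum_univ_three, PiLp.sub_apply, PiLp.add_apply,
      PiLp.smul_apply, smul_eq_mul, RCLike.inner_apply, conj_trivial]
    have f1 : π x * (pderivD 0 w x 0 + pderivD 1 w x 1 + pderivD 2 w x 2) = 0 := by
      rw [e1, mul_zero]
    have f2 : 1 / 2 * (w x 0 * w x 0 + w x 1 * w x 1 + w x 2 * w x 2) *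
        (pderivD 0 u x 0 + pderivD 1 u x 1 + pderivD 2 u x 2) = 0 := by
      rw [e2, mul_zero]
    have nn : ∀ i j, 0 ≤ pderivD i w x j * pderivD i w x j := fun i j => mul_self_nonneg _
    have n1 := nn 0 0
    have n2 := nn 0 1
    have n3 := nn 0 2
    have n4 := nn 1 0
    have n5 := nn 1 1
    have n6 := nn 1 2
    have n7 := nn 2 0
    have n8 := nn 2 1
    have n9 := nn 2 2
    linarith

/-! ### Fields on space-time and integrals depending on time. -/

theorem uniqueDiffOn_spaceTime (T : ℝ) : UniqueDiffOn ℝ (Ico 0 T ×ˢ cylD) :=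
  (uniqueDiffOn_Ico 0 T).prod uniqueDiffOn_cylD

theorem Icc_subset_Ico_of_mem {t₁ T : ℝ} (h : t₁ < T) : Icc 0 t₁ ⊆ Ico 0 T :=
  fun _ ht => ⟨ht.1, ht.2.trans_lt h⟩

section SpaceTime

variable {F : Type*} [NormedAddCommGroup F] {T : ℝ} {g : ℝ → E3 → F}

theorem exists_bound_of_continuousOn_spaceTime
    (hg : ContinuousOn (fun z : ℝ × E3 => g z.1 z.2) (Ico 0 T ×ˢ cylD)) {t₁ : ℝ} (ht₁ : t₁ < T) :
    ∃ M : ℝ, ∀ t ∈ Icc 0 t₁, ∀ x ∈ cylD, ‖g t x‖ ≤ M := by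
  obtain ⟨M, hM⟩ := (isCompact_Icc.prod isCompact_cylD).exists_bound_of_continuousOn
    (hg.mono (prod_mono (Icc_subset_Ico_of_mem ht₁) Subset.rfl))
  exact ⟨M, fun t ht x hx => hM (t, x) ⟨ht, hx⟩⟩

variable [NormedSpace ℝ F]

theorem contDiffOn_slice {n : WithTop ℕ∞}
    (hg : ContDiffOn ℝ n (fun z : ℝ × E3 => g z.1 z.2) (Ico 0 T ×ˢ cylD))
    {t : ℝ} (ht : t ∈ Ico 0 T) : ContDiffOn ℝ n (g t) cylD :=
  hg.comp (f := fun x : E3 => (t, x)) (by fun_prop) fun _ hx => ⟨ht, hx⟩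

theorem hasDerivWithinAt_time
    (hg : ContDiffOn ℝ 1 (fun z : ℝ × E3 => g z.1 z.2) (Ico 0 T ×ˢ cylD))
    {t : ℝ} (ht : t ∈ Ico 0 T) {x : E3} (hx : x ∈ cylD) :
    HasDerivWithinAt (fun s => g s x)
      (fderivWithin ℝ (fun z : ℝ × E3 => g z.1 z.2) (Ico 0 T ×ˢ cylD) (t, x) (1, 0))
      (Ico 0 T) t :=
  ((hg.differentiableOn one_ne_zero (t, x) ⟨ht, hx⟩).hasFDerivWithinAt).comp_hasDerivWithinAt
    (f := fun s : ℝ => (s, x)) t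
    ((hasDerivAt_id t).prodMk (hasDerivAt_const t x)).hasDerivWithinAt fun _ hs => ⟨hs, hx⟩

theorem continuousOn_fderivWithin_space
    (hg : ContDiffOn ℝ 1 (fun z : ℝ × E3 => g z.1 z.2) (Ico 0 T ×ˢ cylD)) :
    ContinuousOn (fun z : ℝ × E3 => fderivWithin ℝ (g z.1) cylD z.2) (Ico 0 T ×ˢ cylD) := by
  have h := hg.continuousOn_fderivWithin (uniqueDiffOn_spaceTime T) le_rfl
  refine (h.clm_comp (continuousOn_const (c := ContinuousLinearMap.inr ℝ ℝ E3))).congr ?_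
  rintro ⟨t, x⟩ ⟨ht, hx⟩
  exact (((hg.differentiableOn one_ne_zero (t, x) ⟨ht, hx⟩).hasFDerivWithinAt).comp
    (f := fun y : E3 => (t, y)) x (hasFDerivAt_prodMk_right t x).hasFDerivWithinAt
    fun _ hy => ⟨ht, hy⟩).fderivWithin (uniqueDiffOn_cylD x hx)

theorem continuousOn_setIntegral_cylD
    (hg : ContinuousOn (fun z : ℝ × E3 => g z.1 z.2) (Ico 0 T ×ˢ cylD)) {t₁ : ℝ} (ht₁ : t₁ < T) :
    ContinuousOn (fun t => ∫ x in cylD, g t x) (Icc 0 t₁) := by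
  obtain ⟨M, hM⟩ := exists_bound_of_continuousOn_spaceTime hg ht₁
  have hsub := Icc_subset_Ico_of_mem ht₁
  refine continuousOn_of_dominated (bound := fun _ => M) (fun t ht => ?_) (fun t ht => ?_)
    (integrable_const M) ?_
  · exact (hg.comp (f := fun x : E3 => (t, x)) (by fun_prop)
      fun _ hx => ⟨hsub ht, hx⟩).aestronglyMeasurable_of_isCompact isCompact_cylD measurableSet_cylD
  · filter_upwards [ae_restrict_mem measurableSet_cylD] with x hx using hM t ht x hx
  · filter_upwards [ae_restrict_mem measurableSet_cylD] with x hx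
    exact hg.comp (f := fun t : ℝ => (t, x)) (by fun_prop) fun _ ht => ⟨hsub ht, hx⟩

theorem hasDerivAt_setIntegral_cylD
    (hg : ContDiffOn ℝ 1 (fun z : ℝ × E3 => g z.1 z.2) (Ico 0 T ×ˢ cylD))
    {t : ℝ} (ht : t ∈ Ioo 0 T) :
    HasDerivAt (fun t => ∫ x in cylD, g t x)
      (∫ x in cylD, derivWithin (fun s => g s x) (Ico 0 T) t) t := by
  have hD : ContinuousOn (fun z : ℝ × E3 => fderivWithin ℝ (fun z : ℝ × E3 => g z.1 z.2)
      (Ico 0 T ×ˢ cylD) (z.1, z.2) (1, 0)) (Ico 0 T ×ˢ cylD) :=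
    (hg.continuousOn_fderivWithin (uniqueDiffOn_spaceTime T) le_rfl).clm_apply continuousOn_const
  -- The time derivative may be unbounded near `T`; compactness gives a dominating constant only up
  -- to some `t₁ < T`.
  obtain ⟨t₁, h1, h2⟩ := exists_between ht.2
  obtain ⟨M, hM⟩ := exists_bound_of_continuousOn_spaceTime
    (g := fun t x => fderivWithin ℝ (fun z : ℝ × E3 => g z.1 z.2)
      (Ico 0 T ×ˢ cylD) (t, x) (1, 0)) hD h2
  have hsub := Icc_subset_Ico_of_mem h2
  have hsec : ∀ {G : ℝ → E3 → F}, ContinuousOn (fun z : ℝ × E3 => G z.1 z.2) (Ico 0 T ×ˢ cylD) →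
      ∀ s ∈ Ico 0 T, ContinuousOn (G s) cylD := fun hG s hs =>
    hG.comp (f := fun x : E3 => (s, x)) (by fun_prop) fun _ hx => ⟨hs, hx⟩
  have h := (hasDerivAt_integral_of_dominated_loc_of_deriv_le (μ := volume.restrict cylD)
    (F := g) (bound := fun _ => M) (F' := fun t x => fderivWithin ℝ (fun z : ℝ × E3 => g z.1 z.2)
      (Ico 0 T ×ˢ cylD) (t, x) (1, 0)) (Ioo_mem_nhds ht.1 h1) ?_ ?_ ?_ ?_
    (integrable_const M) ?_).2
  · convert h using 1
    refine setIntegral_congr_fun measurableSet_cylD fun x hx => ?_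
    exact (hasDerivWithinAt_time hg ⟨ht.1.le, ht.2⟩ hx).derivWithin
      (uniqueDiffOn_Ico 0 T t ⟨ht.1.le, ht.2⟩)
  · filter_upwards [Ioo_mem_nhds ht.1 ht.2] with s hs
    exact (hsec hg.continuousOn s ⟨hs.1.le, hs.2⟩).aestronglyMeasurable_of_isCompact
      isCompact_cylD measurableSet_cylD
  · exact (hsec hg.continuousOn t ⟨ht.1.le, ht.2⟩).integrableOn_compact isCompact_cylD
  · exact (hsec (G := fun t x => fderivWithin ℝ (fun z : ℝ × E3 => g z.1 z.2)
      (Ico 0 T ×ˢ cylD) (t, x) (1, 0)) hD t ⟨ht.1.le, ht.2⟩).aestronglyMeasurable_of_isCompact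
      isCompact_cylD measurableSet_cylD
  · filter_upwards [ae_restrict_mem measurableSet_cylD] with x hx s hs
    exact hM s ⟨hs.1.le, hs.2.le⟩ x hx
  · filter_upwards [ae_restrict_mem measurableSet_cylD] with x hx s hs
    have hs' : s ∈ Ioo 0 T := ⟨hs.1, hs.2.trans h2⟩
    exact (hasDerivWithinAt_time hg ⟨hs'.1.le, hs'.2⟩ hx).hasDerivAt (Ico_mem_nhds hs'.1 hs'.2)

end SpaceTime

/-! ### Uniqueness of classical solutions. -/

/-- Classical solutions with the same force and initial velocity coincide. -/
theorem IsClassicalNSSolution.unique {T : ℝ} {f : ℝ → E3 → E3} {v₀ : E3 → E3}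
    {u v : ℝ → E3 → E3} {Q P : ℝ → E3 → ℝ} (hu : IsClassicalNSSolution T f v₀ u Q)
    (hv : IsClassicalNSSolution T f v₀ v P) : ∀ t ∈ Ico 0 T, ∀ x ∈ cylD, u t x = v t x := by
  let w : ℝ → E3 → E3 := fun t => u t - v t
  have hwC : ContDiffOn ℝ 1 (fun z : ℝ × E3 => w z.1 z.2) (Ico 0 T ×ˢ cylD) :=
    hu.velocity_C1.sub hv.velocity_C1
  have hnC : ContDiffOn ℝ 1 (fun z : ℝ × E3 => ‖w z.1 z.2‖ ^ 2) (Ico 0 T ×ˢ cylD) :=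
    hwC.norm_sq ℝ
  have hud : ∀ t ∈ Ico 0 T, ∀ x ∈ cylD, DifferentiableWithinAt ℝ (u t) cylD x := fun t ht x hx =>
    (hu.velocity_C2 t ht).differentiableOn two_ne_zero x hx
  have hvd : ∀ t ∈ Ico 0 T, ∀ x ∈ cylD, DifferentiableWithinAt ℝ (v t) cylD x := fun t ht x hx =>
    (hv.velocity_C2 t ht).differentiableOn two_ne_zero x hx
  have hwd : ∀ t ∈ Ico 0 T, ∀ x ∈ cylD, fderivWithin ℝ (w t) cylD x =
      fderivWithin ℝ (u t) cylD x - fderivWithin ℝ (v t) cylD x := fun t ht x hx =>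
    fderivWithin_sub (uniqueDiffOn_cylD x hx) (hud t ht x hx) (hvd t ht x hx)
  have hwt : ∀ t ∈ Ico 0 T, ∀ x ∈ cylD, HasDerivWithinAt (fun s => w s x)
      (derivWithin (fun s => w s x) (Ico 0 T) t) (Ico 0 T) t := fun t ht x hx =>
    (hasDerivWithinAt_time hwC ht hx).differentiableWithinAt.hasDerivWithinAt
  have hder : ∀ t ∈ Ico 0 T, ∀ x ∈ cylD, derivWithin (fun s => ‖w s x‖ ^ 2) (Ico 0 T) t =
      2 * inner ℝ (w t x) (derivWithin (fun s => w s x) (Ico 0 T) t) := fun t ht x hx =>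
    ((hwt t ht x hx).norm_sq).derivWithin (uniqueDiffOn_Ico 0 T t ht)
  -- The splitting `u·∇u - v·∇v = u·∇w + w·∇v`: the first term transports `w` and contributes no
  -- energy, the second is controlled by the bound on `∇v`.
  have heq : ∀ t ∈ Ico 0 T, ∀ x ∈ cylD, derivWithin (fun s => w s x) (Ico 0 T) t =
      (InnerProductSpace.laplacianWithin (w t) cylD x - fderivWithin ℝ (w t) cylD x (u t x)
        - gradientWithin (Q t - P t) cylD x) - fderivWithin ℝ (v t) cylD x (w t x) := by
    intro t ht x hx
    have e1 := hu.momentum t ht x hx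
    have e2 := hv.momentum t ht x hx
    have e3 : derivWithin (fun s => w s x) (Ico 0 T) t =
        derivWithin (fun s => u s x) (Ico 0 T) t - derivWithin (fun s => v s x) (Ico 0 T) t :=
      derivWithin_fun_sub (hasDerivWithinAt_time hu.velocity_C1 ht hx).differentiableWithinAt
        (hasDerivWithinAt_time hv.velocity_C1 ht hx).differentiableWithinAt
    have e4 : InnerProductSpace.laplacianWithin (w t) cylD x =
        InnerProductSpace.laplacianWithin (u t) cylD x
          - InnerProductSpace.laplacianWithin (v t) cylD x :=
      (hu.velocity_C2 t ht x hx).laplacianWithin_sub (hv.velocity_C2 t ht x hx)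
        uniqueDiffOn_cylD hx
    have e5 : gradientWithin (Q t - P t) cylD x =
        gradientWithin (Q t) cylD x - gradientWithin (P t) cylD x := by
      unfold gradientWithin
      rw [fderivWithin_sub (uniqueDiffOn_cylD x hx)
        ((hu.pressure_C1 t ht).differentiableOn one_ne_zero x hx)
        ((hv.pressure_C1 t ht).differentiableOn one_ne_zero x hx), map_sub]
    rw [convD_eq] at e1 e2
    have e6 : w t x = u t x - v t x := rfl
    rw [e3, e4, e5, hwd t ht x hx, e6, map_sub, sub_apply]
    have e7 := e1.trans e2.symm
    rw [← sub_eq_zero] at e7 ⊢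
    rw [← neg_eq_zero, ← e7]
    abel
  have hneg : ∀ t ∈ Ico 0 T, ∫ x in cylD, inner ℝ (w t x)
      (InnerProductSpace.laplacianWithin (w t) cylD x - fderivWithin ℝ (w t) cylD x (u t x)
        - gradientWithin (Q t - P t) cylD x) ≤ 0 := by
    intro t ht
    have hpd : ∀ x ∈ cylD, ∀ i, pderivD i (w t) x = pderivD i (u t) x - pderivD i (v t) x := by
      intro x hx i
      simp [pderivD, hwd t ht x hx]
    refine integral_inner_laplacian_sub_transport_le
      ((hu.velocity_C2 t ht).sub (hv.velocity_C2 t ht))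
      ((hu.velocity_C2 t ht).of_le (by norm_num))
      ((hu.pressure_C1 t ht).sub (hv.pressure_C1 t ht)) (fun x hx => ?_)
      (hu.incompressible t ht) (fun x hx => ?_) (fun x hx => ?_)
      (fun x hx => (hu.totalSlip t ht x hx).1)
    · have e1 := hu.incompressible t ht x hx
      have e2 := hv.incompressible t ht x hx
      simp only [divD, Fin.sum_univ_three] at e1 e2 ⊢
      simp only [hpd x hx, PiLp.sub_apply]
      linarith
    · simp [w, hu.noSlip t ht x hx, hv.noSlip t ht x hx]
    · obtain ⟨a1, a2, a3⟩ := hu.totalSlip t ht x hx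
      obtain ⟨b1, b2, b3⟩ := hv.totalSlip t ht x hx
      rw [hpd x hx.1]
      simp [w, a1, a2, a3, b1, b2, b3]
  intro t₁ ht₁
  obtain ⟨K, hK⟩ := exists_bound_of_continuousOn_spaceTime
    (g := fun t x => fderivWithin ℝ (v t) cylD x)
    (continuousOn_fderivWithin_space hv.velocity_C1) ht₁.2
  have hsub := Icc_subset_Ico_of_mem ht₁.2
  let E : ℝ → ℝ := fun t => ∫ x in cylD, ‖w t x‖ ^ 2
  have hEd : ∀ t ∈ Ioo 0 t₁, ∃ E', HasDerivAt E E' t ∧ E' ≤ 2 * K * E t := by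
    intro t ht
    have ht' : t ∈ Ico 0 T := ⟨ht.1.le, ht.2.trans ht₁.2⟩
    refine ⟨_, hasDerivAt_setIntegral_cylD (g := fun t x => ‖w t x‖ ^ 2) hnC ⟨ht.1, ht'.2⟩, ?_⟩
    have hi1 : IntegrableOn (fun x => inner ℝ (w t x)
        (fderivWithin ℝ (v t) cylD x (w t x))) cylD := by
      refine ContinuousOn.integrableOn_compact isCompact_cylD ?_
      have hwc := (contDiffOn_slice hwC ht').continuousOn
      exact hwc.inner (((hv.velocity_C2 t ht').continuousOn_fderivWithin
        uniqueDiffOn_cylD (by norm_num)).clm_apply hwc)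
    have hi2 : IntegrableOn (fun x => inner ℝ (w t x)
        (derivWithin (fun s => w s x) (Ico 0 T) t)) cylD := by
      refine ContinuousOn.integrableOn_compact isCompact_cylD ?_
      refine (contDiffOn_slice hwC ht').continuousOn.inner ?_
      refine ContinuousOn.congr (f := fun x => fderivWithin ℝ (fun z : ℝ × E3 => w z.1 z.2)
        (Ico 0 T ×ˢ cylD) (t, x) (1, 0)) ?_ fun x hx =>
          (hasDerivWithinAt_time hwC ht' hx).derivWithin (uniqueDiffOn_Ico 0 T t ht')
      exact ((hwC.continuousOn_fderivWithin (uniqueDiffOn_spaceTime T) le_rfl).comp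
        (f := fun x : E3 => (t, x)) (by fun_prop) fun _ hx => ⟨ht', hx⟩).clm_apply
          continuousOn_const
    have hle : ∫ x in cylD, inner ℝ (w t x) (derivWithin (fun s => w s x) (Ico 0 T) t)
        + inner ℝ (w t x) (fderivWithin ℝ (v t) cylD x (w t x)) ≤ 0 := by
      refine le_trans (le_of_eq ?_) (hneg t ht')
      refine setIntegral_congr_fun measurableSet_cylD fun x hx => ?_
      simp only [heq t ht' x hx]
      rw [← inner_add_right, sub_add_cancel]
    rw [integral_add hi2 hi1] at hle
    have hlow : -(K * E t) ≤
        ∫ x in cylD, inner ℝ (w t x) (fderivWithin ℝ (v t) cylD x (w t x)) := by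
      rw [← integral_const_mul, ← integral_neg]
      refine setIntegral_mono_on ?_ hi1 measurableSet_cylD fun x hx => ?_
      · exact ((((contDiffOn_slice hwC ht').continuousOn.norm.pow 2).integrableOn_compact
          isCompact_cylD).const_mul K).neg
      · have h1 := abs_real_inner_le_norm (w t x) (fderivWithin ℝ (v t) cylD x (w t x))
        have h2 := (fderivWithin ℝ (v t) cylD x).le_of_opNorm_le
          (hK t ⟨ht.1.le, ht.2.le⟩ x hx) (w t x)
        have h3 := mul_le_mul_of_nonneg_left h2 (norm_nonneg (w t x))
        have h4 := (abs_le.1 h1).1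
        nlinarith
    have hcg : ∫ x in cylD, derivWithin (fun s => ‖w s x‖ ^ 2) (Ico 0 T) t =
        2 * ∫ x in cylD, inner ℝ (w t x) (derivWithin (fun s => w s x) (Ico 0 T) t) := by
      rw [← integral_const_mul]
      exact setIntegral_congr_fun measurableSet_cylD fun x hx => hder t ht' x hx
    rw [hcg]
    linarith
  have hEc : ContinuousOn E (Icc 0 t₁) :=
    continuousOn_setIntegral_cylD (g := fun t x => ‖w t x‖ ^ 2) hnC.continuousOn ht₁.2
  -- Grönwall's argument in integrating-factor form.
  have hanti : AntitoneOn (fun t => E t * Real.exp (-(2 * K) * t)) (Icc 0 t₁) := by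
    have hexp : ∀ t : ℝ, HasDerivAt (fun t => Real.exp (-(2 * K) * t))
        (Real.exp (-(2 * K) * t) * -(2 * K)) t := fun t => by
      simpa using ((hasDerivAt_id t).const_mul (-(2 * K))).exp
    refine antitoneOn_of_deriv_nonpos (convex_Icc _ _) (hEc.mul (by fun_prop)) ?_ ?_
    · rw [interior_Icc]
      intro t ht
      obtain ⟨E', h1, -⟩ := hEd t ht
      exact (h1.mul (hexp t)).differentiableAt.differentiableWithinAt
    · rw [interior_Icc]
      intro t ht
      obtain ⟨E', h1, h2⟩ := hEd t ht
      have h3 : deriv (fun t => E t * Real.exp (-(2 * K) * t)) t = _ := (h1.mul (hexp t)).deriv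
      rw [h3]
      nlinarith [Real.exp_pos (-(2 * K) * t)]
  have hE0 : E 0 = 0 := by
    have h0 : (0 : ℝ) ∈ Ico 0 T := ⟨le_rfl, ht₁.1.trans_lt ht₁.2⟩
    have : E 0 = ∫ x in cylD, (0 : ℝ) := by
      refine setIntegral_congr_fun measurableSet_cylD fun x hx => ?_
      simp [w, hu.initial x hx, hv.initial x hx]
    rw [this, integral_zero]
  have hE1 : E t₁ ≤ 0 := by
    have h := hanti (left_mem_Icc.2 ht₁.1) (right_mem_Icc.2 ht₁.1) ht₁.1
    simp only [hE0, zero_mul] at h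
    exact nonpos_of_mul_nonpos_left h (Real.exp_pos _)
  have hwc := (contDiffOn_slice hwC ht₁).continuousOn
  have hae : (fun x => ‖w t₁ x‖ ^ 2) =ᵐ[volume.restrict cylD] 0 :=
    (setIntegral_eq_zero_iff_of_nonneg_ae (ae_of_all _ fun x => sq_nonneg _)
      ((hwc.norm.pow 2).integrableOn_compact isCompact_cylD)).1
      (le_antisymm hE1 (integral_nonneg fun x => sq_nonneg _))
  intro x hx
  have := Measure.eqOn_of_ae_eq hae (hwc.norm.pow 2) continuousOn_const
    cylD_subset_closure_interior hx
  have h0 : w t₁ x = 0 := by simpa using this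
  exact sub_eq_zero.1 h0

/-! ### Calculus of swirling fields. -/

noncomputable section

/-- The generator of the rotations about the vertical axis, `x ↦ (-x₁, x₀, 0)`. -/
def rotGen : E3 →L[ℝ] E3 :=
  (EuclideanSpace.proj 0 : E3 →L[ℝ] ℝ).smulRight (stdVec 1)
    - (EuclideanSpace.proj 1 : E3 →L[ℝ] ℝ).smulRight (stdVec 0)

/-- The `i`-th coordinate of the horizontal projection. -/
def horCoord (i : Fin 3) : E3 →L[ℝ] ℝ := if i = 2 then 0 else EuclideanSpace.proj i

/-- The squared distance to the vertical axis. -/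
def radSq (x : E3) : ℝ := x 0 ^ 2 + x 1 ^ 2

@[simp] theorem rotGen_zero_coord (x : E3) : rotGen x 0 = -x 1 := by simp [rotGen, stdVec]

@[simp] theorem rotGen_one_coord (x : E3) : rotGen x 1 = x 0 := by simp [rotGen, stdVec]

@[simp] theorem rotGen_two_coord (x : E3) : rotGen x 2 = 0 := by simp [rotGen, stdVec]

theorem norm_rotGen (x : E3) : ‖rotGen x‖ = √(radSq x) := by
  rw [EuclideanSpace.norm_eq, Fin.sum_univ_three]
  simp [radSq, add_comm]

theorem radSq_nonneg (x : E3) : 0 ≤ radSq x := by unfold radSq; positivity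

theorem contDiff_radSq {n : WithTop ℕ∞} : ContDiff ℝ n radSq := by
  unfold radSq
  fun_prop

theorem horCoord_mul_self_le (i : Fin 3) (x : E3) : horCoord i x ^ 2 ≤ radSq x := by
  unfold radSq
  fin_cases i <;> simp [horCoord] <;> positivity

theorem radSq_mem_Icc {x : E3} (hx : x ∈ cylD) : radSq x ∈ Icc (0 : ℝ) 1 :=
  ⟨radSq_nonneg x, hx.1⟩

/-- The derivative of `radSq`. -/
def radSqDeriv (x : E3) : E3 →L[ℝ] ℝ :=
  (2 * x 0) • (EuclideanSpace.proj 0 : E3 →L[ℝ] ℝ)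
    + (2 * x 1) • (EuclideanSpace.proj 1 : E3 →L[ℝ] ℝ)

theorem hasFDerivAt_radSq (x : E3) :
    HasFDerivAt radSq (radSqDeriv x) x := by
  have h := fun i => (EuclideanSpace.proj i : E3 →L[ℝ] ℝ).hasFDerivAt (x := x)
  have h2 := ((h 0).pow 2).add ((h 1).pow 2)
  refine h2.congr_fderiv ?_
  ext y
  simp [radSqDeriv]

theorem hasFDerivAt_comp_radSq {φ : ℝ → ℝ} {φ' : ℝ} {x : E3} (h : HasDerivAt φ φ' (radSq x)) :
    HasFDerivAt (fun y => φ (radSq y)) (φ' • radSqDeriv x) x :=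
  h.comp_hasFDerivAt x (hasFDerivAt_radSq x)

theorem radSq_fderiv_stdVec (x : E3) (i : Fin 3) :
    radSqDeriv x (stdVec i) = 2 * horCoord i x := by
  fin_cases i <;> simp [radSqDeriv, horCoord, stdVec]

section Swirl

variable {φ φ₁ φ₂ : ℝ → ℝ} {x : E3}

theorem fderivWithin_comp_radSq (hx : x ∈ cylD) {c : ℝ} (h : HasDerivAt φ c (radSq x))
    (i : Fin 3) :
    fderivWithin ℝ (fun y => φ (radSq y)) cylD x (stdVec i) = 2 * horCoord i x * c := by
  rw [(hasFDerivAt_comp_radSq h).hasFDerivWithinAt.fderivWithin (uniqueDiffOn_cylD x hx),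
    smul_apply, radSq_fderiv_stdVec, smul_eq_mul, mul_comm]

theorem pderivD_swirl (hx : x ∈ cylD) {c : ℝ} (h : HasDerivAt φ c (radSq x)) (i : Fin 3) :
    pderivD i (fun y => φ (radSq y) • rotGen y) x =
      (2 * horCoord i x * c) • rotGen x + φ (radSq x) • rotGen (stdVec i) := by
  have h1 := (hasFDerivAt_comp_radSq h).smul (rotGen.hasFDerivAt (x := x))
  have h2 : fderivWithin ℝ (fun y => φ (radSq y) • rotGen y) cylD x = _ :=
    h1.hasFDerivWithinAt.fderivWithin (uniqueDiffOn_cylD x hx)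
  rw [pderivD, h2, add_apply, smul_apply, ContinuousLinearMap.smulRight_apply, smul_apply,
    radSq_fderiv_stdVec, smul_eq_mul,
    mul_comm c, add_comm]

/-- The gradient of `φ(r²)` is radial, hence orthogonal to `rotGen x`, and `rotGen` is
antisymmetric, hence trace free. -/
theorem divD_swirl (hx : x ∈ cylD) {c : ℝ} (h : HasDerivAt φ c (radSq x)) :
    divD (fun y => φ (radSq y) • rotGen y) x = 0 := by
  simp only [divD, pderivD_swirl hx h, Fin.sum_univ_three]
  simp [horCoord, stdVec]
  ring

/-- Particles move on circles about the axis with angular velocity `φ`, so only the centripetal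
acceleration remains and `φ'` drops out. Being radial with a coefficient depending on `r²`, it is a
gradient. -/
theorem convD_swirl (hx : x ∈ cylD) {c : ℝ} (h : HasDerivAt φ c (radSq x)) (i : Fin 3) :
    convD (fun y => φ (radSq y) • rotGen y) x i = -(φ (radSq x) ^ 2 * horCoord i x) := by
  simp only [convD, pderivD_swirl hx h, Fin.sum_univ_three]
  fin_cases i <;> simp [horCoord, stdVec] <;> ring

/-- The planar Laplacian of `φ(r²)` is `4sφ'' + 4φ'`; the cross term `2 ∇φ·∇(rotGen x)` adds another
`4φ' rotGen x`, since `rotGen` is linear. -/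
theorem laplacianWithin_swirl (hx : x ∈ cylD) (h : ∀ s ∈ Icc (0 : ℝ) 1, HasDerivAt φ (φ₁ s) s)
    (h₁ : ∀ s ∈ Icc (0 : ℝ) 1, HasDerivAt φ₁ (φ₂ s) s)
    (hC : ContDiffOn ℝ 2 (fun y => φ (radSq y) • rotGen y) cylD) :
    InnerProductSpace.laplacianWithin (fun y => φ (radSq y) • rotGen y) cylD x =
      (4 * radSq x * φ₂ (radSq x) + 8 * φ₁ (radSq x)) • rotGen x := by
  rw [laplacianWithin_cylD_eq hC hx]
  have key : ∀ i, pderivD i (pderivD i (fun y => φ (radSq y) • rotGen y)) x =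
      (2 * horCoord i (stdVec i) * φ₁ (radSq x) + 4 * horCoord i x ^ 2 * φ₂ (radSq x)) • rotGen x
        + (4 * horCoord i x * φ₁ (radSq x)) • rotGen (stdVec i) := by
    intro i
    have h2 := (((horCoord i).hasFDerivAt (x := x)).const_mul 2).mul
      (hasFDerivAt_comp_radSq (h₁ _ (radSq_mem_Icc hx)))
    have h3 := (h2.smul (rotGen.hasFDerivAt (x := x))).add
      ((hasFDerivAt_comp_radSq (h _ (radSq_mem_Icc hx))).smul_const (rotGen (stdVec i)))
    have h4 : fderivWithin ℝ (fun y => (2 * horCoord i y * φ₁ (radSq y)) • rotGen y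
        + φ (radSq y) • rotGen (stdVec i)) cylD x = _ :=
      h3.hasFDerivWithinAt.fderivWithin (uniqueDiffOn_cylD x hx)
    rw [pderivD, fderivWithin_congr (fun y hy => pderivD_swirl hy (h _ (radSq_mem_Icc hy)) i)
      (pderivD_swirl hx (h _ (radSq_mem_Icc hx)) i), h4]
    simp only [add_apply, smul_apply, ContinuousLinearMap.smulRight_apply, radSq_fderiv_stdVec,
      smul_eq_mul, Pi.mul_apply]
    module
  simp only [key, Fin.sum_univ_three]
  ext j
  fin_cases j <;> simp [horCoord, stdVec, radSq] <;> ring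

end Swirl

/-! ### The explicit profile and the solution it generates. -/

/-- The angular velocity profile of the solution. -/
def profile (T k t s : ℝ) : ℝ := (1 - s) * (s + (T - t)) ^ (-k)

/-- The derivative of the profile in `s`. -/
def profileD (T k t s : ℝ) : ℝ :=
  -(s + (T - t)) ^ (-k) - (1 - s) * (k * (s + (T - t)) ^ (-k - 1))

/-- The second derivative of the profile in `s`. -/
def profileDD (T k t s : ℝ) : ℝ :=
  2 * k * (s + (T - t)) ^ (-k - 1) + (1 - s) * (k * (k + 1) * (s + (T - t)) ^ (-k - 2))

/-- The derivative of the profile in time. -/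
def profileDt (T k t s : ℝ) : ℝ := (1 - s) * (k * (s + (T - t)) ^ (-k - 1))

/-- A primitive of the square of the profile. -/
def profileSqInt (T k t s : ℝ) : ℝ :=
  (1 + (T - t)) ^ 2 * ((s + (T - t)) ^ (1 - 2 * k) / (1 - 2 * k))
    - 2 * (1 + (T - t)) * ((s + (T - t)) ^ (2 - 2 * k) / (2 - 2 * k))
    + (s + (T - t)) ^ (3 - 2 * k) / (3 - 2 * k)

section Profile

variable {T k t s : ℝ}

theorem hasDerivAt_shift_rpow (e : ℝ) {τ : ℝ} (h : 0 < s + τ) :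
    HasDerivAt (fun s => (s + τ) ^ e) (e * (s + τ) ^ (e - 1)) s := by
  simpa using ((hasDerivAt_id s).add_const τ).rpow_const (p := e) (Or.inl h.ne')

theorem hasDerivAt_profile (h : 0 < s + (T - t)) :
    HasDerivAt (profile T k t) (profileD T k t s) s := by
  have h1 := ((hasDerivAt_id s).const_sub 1).mul (hasDerivAt_shift_rpow (-k) h)
  refine h1.congr_deriv ?_
  simp only [profileD, id]
  ring

theorem hasDerivAt_profileD (h : 0 < s + (T - t)) :
    HasDerivAt (profileD T k t) (profileDD T k t s) s := by
  have h1 := (hasDerivAt_shift_rpow (-k) h).neg.sub (((hasDerivAt_id s).const_sub 1).mul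
    ((hasDerivAt_shift_rpow (-k - 1) h).const_mul k))
  refine h1.congr_deriv ?_
  simp only [profileDD, id, show -k - 1 - 1 = -k - 2 by ring]
  ring

theorem hasDerivAt_profile_time (h : 0 < s + (T - t)) :
    HasDerivAt (fun t => profile T k t s) (profileDt T k t s) t := by
  have h1 := (((hasDerivAt_id t).const_sub T).const_add s).rpow_const (p := -k) (Or.inl h.ne')
  have h2 := h1.const_mul (1 - s)
  refine h2.congr_deriv ?_
  simp only [profileDt, id]
  ring

/-- With `τ = T - t`, expanding `1 - s = (1 + τ) - (s + τ)` turns the square into three powers of `s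
+ τ`. The bounds on `k` keep every denominator nonzero. -/
theorem hasDerivAt_profileSqInt (hk : 1 / 2 < k) (hk1 : k < 1) (h : 0 < s + (T - t)) :
    HasDerivAt (profileSqInt T k t) (profile T k t s ^ 2) s := by
  have h1 := (((hasDerivAt_shift_rpow (1 - 2 * k) h).div_const (1 - 2 * k)).const_mul
    ((1 + (T - t)) ^ 2)).sub
    (((hasDerivAt_shift_rpow (2 - 2 * k) h).div_const (2 - 2 * k)).const_mul
      (2 * (1 + (T - t)))) |>.add
    ((hasDerivAt_shift_rpow (3 - 2 * k) h).div_const (3 - 2 * k))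
  refine h1.congr_deriv ?_
  have a1 : 1 - 2 * k ≠ 0 := by linarith
  have a2 : 2 - 2 * k ≠ 0 := by linarith
  have a3 : 3 - 2 * k ≠ 0 := by linarith
  rw [mul_div_cancel_left₀ _ a1, mul_div_cancel_left₀ _ a2, mul_div_cancel_left₀ _ a3,
    show 1 - 2 * k - 1 = -k + -k by ring, show 2 - 2 * k - 1 = -k + -k + 1 by ring,
    show 3 - 2 * k - 1 = -k + -k + 1 + 1 by ring, Real.rpow_add_one h.ne', Real.rpow_add_one h.ne',
    Real.rpow_add_one h.ne', Real.rpow_add h]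
  simp only [profile]
  ring

end Profile

/-- The swirling velocity field concentrating on the vertical axis. -/
def swirlVelocity (T k t : ℝ) (x : E3) : E3 := profile T k t (radSq x) • rotGen x

/-- The pressure of the swirling flow. -/
def swirlPressure (T k t : ℝ) (x : E3) : ℝ := 1 / 2 * profileSqInt T k t (radSq x)

/-- The force driving the swirling flow. -/
def swirlForce (T k t : ℝ) (x : E3) : E3 :=
  (4 * radSq x * profileDD T k t (radSq x) + 8 * profileD T k t (radSq x)
    - profileDt T k t (radSq x)) • rotGen x

theorem radSq_add_pos {T t : ℝ} (ht : t < T) (x : E3) : 0 < radSq x + (T - t) :=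
  add_pos_of_nonneg_of_pos (radSq_nonneg x) (sub_pos.2 ht)

theorem contDiffOn_radSq_rpow {n : WithTop ℕ∞} (T e : ℝ) :
    ContDiffOn ℝ n (fun z : ℝ × E3 => (radSq z.2 + (T - z.1)) ^ e) (Ico 0 T ×ˢ cylD) := by
  refine ContDiffOn.rpow_const_of_ne ?_ fun z hz => (radSq_add_pos hz.1.2 z.2).ne'
  exact ((contDiff_radSq.comp contDiff_snd).add (contDiff_const.sub contDiff_fst)).contDiffOn

theorem contDiffOn_swirlVelocity {n : WithTop ℕ∞} (T k : ℝ) :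
    ContDiffOn ℝ n (fun z : ℝ × E3 => swirlVelocity T k z.1 z.2) (Ico 0 T ×ˢ cylD) := by
  have hr : ContDiffOn ℝ n (fun z : ℝ × E3 => radSq z.2) (Ico 0 T ×ˢ cylD) :=
    (contDiff_radSq.comp contDiff_snd).contDiffOn
  have hJ : ContDiffOn ℝ n (fun z : ℝ × E3 => rotGen z.2) (Ico 0 T ×ˢ cylD) :=
    (rotGen.contDiff.comp contDiff_snd).contDiffOn
  exact ((contDiffOn_const.sub hr).mul (contDiffOn_radSq_rpow T _)).smul hJ

theorem contDiffOn_swirlForce {n : WithTop ℕ∞} (T k : ℝ) :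
    ContDiffOn ℝ n (fun z : ℝ × E3 => swirlForce T k z.1 z.2) (Ico 0 T ×ˢ cylD) := by
  have hr : ContDiffOn ℝ n (fun z : ℝ × E3 => radSq z.2) (Ico 0 T ×ˢ cylD) :=
    (contDiff_radSq.comp contDiff_snd).contDiffOn
  have hJ : ContDiffOn ℝ n (fun z : ℝ × E3 => rotGen z.2) (Ico 0 T ×ˢ cylD) :=
    (rotGen.contDiff.comp contDiff_snd).contDiffOn
  have h0 := contDiffOn_radSq_rpow (n := n) T (-k)
  have h1 := contDiffOn_radSq_rpow (n := n) T (-k - 1)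
  have h2 := contDiffOn_radSq_rpow (n := n) T (-k - 2)
  have h3 := (contDiffOn_const (c := (1 : ℝ))).sub hr
  exact ((((contDiffOn_const.mul hr).mul ((contDiffOn_const.mul h1).add
    (h3.mul (contDiffOn_const.mul h2)))).add (contDiffOn_const.mul
      (h0.neg.sub (h3.mul (contDiffOn_const.mul h1))))).sub
        (h3.mul (contDiffOn_const.mul h1))).smul hJ

theorem contDiffOn_swirlPressure {n : WithTop ℕ∞} {T t : ℝ} (k : ℝ) (ht : t ∈ Ico 0 T) :
    ContDiffOn ℝ n (swirlPressure T k t) cylD := by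
  have h := fun e => contDiffOn_slice (g := fun t x => (radSq x + (T - t)) ^ e)
    (contDiffOn_radSq_rpow (n := n) T e) ht
  exact contDiffOn_const.mul (((contDiffOn_const.mul ((h _).div_const _)).sub
    (contDiffOn_const.mul ((h _).div_const _))).add ((h _).div_const _))

/-- The swirling flow solves the forced Navier-Stokes equations. -/
theorem isClassicalNSSolution_swirl {T k : ℝ} (hk : 1 / 2 < k) (hk1 : k < 1) :
    IsClassicalNSSolution T (swirlForce T k) (swirlVelocity T k 0) (swirlVelocity T k)
      (swirlPressure T k) := by
  have hpos : ∀ t ∈ Ico 0 T, ∀ s ∈ Icc (0 : ℝ) 1, 0 < s + (T - t) := fun t ht s hs => by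
    linarith [hs.1, ht.2]
  have hd : ∀ t ∈ Ico 0 T, ∀ x ∈ cylD,
      HasDerivAt (profile T k t) (profileD T k t (radSq x)) (radSq x) := fun t ht x hx =>
    hasDerivAt_profile (hpos t ht _ (radSq_mem_Icc hx))
  refine ⟨contDiffOn_swirlVelocity T k, fun t ht => contDiffOn_slice
    (contDiffOn_swirlVelocity T k) ht, fun t ht => contDiffOn_swirlPressure k ht, ?_,
    fun t ht x hx => divD_swirl hx (hd t ht x hx), fun _ _ => rfl, ?_, ?_⟩
  · intro t ht x hx
    have e1 : InnerProductSpace.laplacianWithin (swirlVelocity T k t) cylD x = _ :=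
      laplacianWithin_swirl hx (fun s hs => hasDerivAt_profile (hpos t ht s hs))
        (fun s hs => hasDerivAt_profileD (hpos t ht s hs))
        (contDiffOn_slice (contDiffOn_swirlVelocity T k) ht)
    have e2 : derivWithin (fun s => swirlVelocity T k s x) (Ico 0 T) t = _ :=
      ((hasDerivAt_profile_time (hpos t ht _ (radSq_mem_Icc hx))).smul_const
        (rotGen x)).hasDerivWithinAt.derivWithin (uniqueDiffOn_Ico 0 T t ht)
    have e3 : ∀ i, convD (swirlVelocity T k t) x i = _ := convD_swirl hx (hd t ht x hx)
    have e4 : ∀ i, gradientWithin (swirlPressure T k t) cylD x i =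
        2 * horCoord i x * (1 / 2 * profile T k t (radSq x) ^ 2) := fun i => by
      rw [gradientWithin_apply]
      exact fderivWithin_comp_radSq hx ((hasDerivAt_profileSqInt hk hk1
        (hpos t ht _ (radSq_mem_Icc hx))).const_mul (1 / 2)) i
    rw [e1, e2, swirlForce]
    ext i
    simp only [PiLp.sub_apply, PiLp.smul_apply, e3, e4, smul_eq_mul]
    ring
  · rintro t ht x ⟨hx, h1⟩
    have : radSq x = 1 := h1
    simp [swirlVelocity, profile, this]
  · rintro t ht x ⟨hx, -⟩
    have h : pderivD 2 (swirlVelocity T k t) x = _ := pderivD_swirl hx (hd t ht x hx) 2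
    refine ⟨by simp [swirlVelocity], ?_, ?_⟩ <;> rw [h] <;> simp [horCoord, stdVec]

end

/-! ### Mixed space-time integrability of negative powers. -/

theorem ae_coord_ne_zero (i : Fin 3) : ∀ᵐ x : E3, x i ≠ 0 := by
  have h : (LinearMap.ker (EuclideanSpace.proj i : E3 →L[ℝ] ℝ).toLinearMap) ≠ ⊤ := by
    intro h
    have h1 : stdVec i ∈ LinearMap.ker (EuclideanSpace.proj i : E3 →L[ℝ] ℝ).toLinearMap := by
      rw [h]; trivial
    simp [stdVec] at h1
  have h2 := Measure.addHaar_submodule (volume : Measure E3) _ h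
  rw [ae_iff]
  convert h2 using 2
  ext x
  simp

theorem integrableOn_Icc_abs_rpow {γ : ℝ} (hγ : γ < 1) :
    IntegrableOn (fun y : ℝ => |y| ^ (-γ)) (Icc (-1) 1) := by
  have h1 : IntervalIntegrable (fun y : ℝ => |y| ^ (-γ)) volume 0 1 := by
    refine (intervalIntegral.intervalIntegrable_rpow' (r := -γ) (by linarith)).congr ?_
    intro y hy
    rw [uIoc_of_le zero_le_one] at hy
    simp [abs_of_pos hy.1]
  have h2 : IntervalIntegrable (fun y : ℝ => |y| ^ (-γ)) volume (-1) 0 := by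
    simpa using (h1.comp_sub_left 0).symm
  rw [integrableOn_Icc_iff_integrableOn_Ioc,
    ← intervalIntegrable_iff_integrableOn_Ioc_of_le (by norm_num)]
  exact h2.trans h1

/-- Negative powers of `|x₀ x₁|` of order less than one are integrable on the cylinder. -/
theorem integrableOn_cylD_abs_mul_rpow {γ : ℝ} (hγ : γ < 1) :
    IntegrableOn (fun x : E3 => |x 0 * x 1| ^ (-γ)) cylD := by
  -- The cylinder lies in `[-1, 1]³`, where the function is a product of one-variable integrable
  -- functions; this avoids polar coordinates.
  let F : Fin 3 → ℝ → ℝ := fun i => (Icc (-1) 1).indicator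
    fun y => if i = 2 then 1 else |y| ^ (-γ)
  have hF : ∀ i, Integrable (F i) := by
    intro i
    rw [integrable_indicator_iff measurableSet_Icc]
    by_cases hi : i = 2
    · simp [hi]
    · simpa [hi] using integrableOn_Icc_abs_rpow hγ
  have h1 : Integrable (fun x : Fin 3 → ℝ => ∏ i, F i (x i)) := Integrable.fintype_prod hF
  have h2 : Integrable (fun x : E3 => ∏ i, F i (x i)) :=
    (PiLp.volume_preserving_ofLp (Fin 3)).integrable_comp_of_integrable h1
  refine h2.integrableOn.congr_fun (fun x hx => ?_) measurableSet_cylD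
  obtain ⟨a1, a2, a3⟩ := hx
  have b0 : x 0 ∈ Icc (-1 : ℝ) 1 := by
    rw [mem_Icc, ← abs_le, ← sq_le_one_iff_abs_le_one]; nlinarith [sq_nonneg (x 1)]
  have b1 : x 1 ∈ Icc (-1 : ℝ) 1 := by
    rw [mem_Icc, ← abs_le, ← sq_le_one_iff_abs_le_one]; nlinarith [sq_nonneg (x 0)]
  have b2 : x 2 ∈ Icc (-1 : ℝ) 1 := ⟨by linarith, a3⟩
  simp only [Fin.prod_univ_three, F, indicator_of_mem b0, indicator_of_mem b1, indicator_of_mem b2]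
  simp [abs_mul, Real.mul_rpow]

theorem memLp_cylD_abs_mul_rpow {γ p : ℝ} (hp : 1 ≤ p) (hγ : γ * p < 1) :
    MemLp (fun x : E3 => |x 0 * x 1| ^ (-γ)) (ENNReal.ofReal p) (volume.restrict cylD) := by
  have hp0 : 0 < p := by linarith
  have hm : AEStronglyMeasurable (fun x : E3 => |x 0 * x 1| ^ (-γ)) (volume.restrict cylD) := by
    refine Measurable.aestronglyMeasurable ?_
    fun_prop
  rw [← integrable_norm_rpow_iff hm (by simpa using hp0) ENNReal.ofReal_ne_top,
    ENNReal.toReal_ofReal hp0.le]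
  refine (integrableOn_cylD_abs_mul_rpow hγ).congr (ae_of_all _ fun x => ?_)
  simp only
  rw [Real.norm_of_nonneg (by positivity), ← Real.rpow_mul (abs_nonneg _), neg_mul]

/-- The alternative `y = 0` matters for `q = ∞`, where a constant is admissible although `0 < 1/q`
fails. -/
theorem memLp_time_rpow {T y : ℝ} {q : ℝ≥0∞} (hT : 0 < T) (hq : 1 ≤ q)
    (hy : y = 0 ∨ y < (q⁻¹).toReal) :
    MemLp (fun t : ℝ => (T - t) ^ (-y)) q (volume.restrict (Ioo 0 T)) := by
  rcases hy with rfl | hy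
  · simpa using memLp_const (p := q) (μ := volume.restrict (Ioo 0 T)) (1 : ℝ)
  by_cases hqt : q = ⊤
  · subst hqt
    have hy' : y < 0 := by simpa using hy
    refine memLp_top_of_bound (Measurable.aestronglyMeasurable (by fun_prop)) (T ^ (-y)) ?_
    filter_upwards [ae_restrict_mem measurableSet_Ioo] with t ht
    have h0 : 0 ≤ T - t := by linarith [ht.2]
    rw [Real.norm_of_nonneg (by positivity)]
    exact Real.rpow_le_rpow h0 (by linarith [ht.1]) (by linarith)
  · have hq0 : 0 < q.toReal := ENNReal.toReal_pos (by positivity) hqt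
    rw [← integrable_norm_rpow_iff (Measurable.aestronglyMeasurable (by fun_prop))
      (by positivity) hqt]
    have hyq : y * q.toReal < 1 := by
      rw [ENNReal.toReal_inv] at hy
      rwa [← lt_div_iff₀ hq0, one_div]
    have h1 : IntervalIntegrable (fun t : ℝ => (T - t) ^ (-(y * q.toReal))) volume 0 T := by
      have := ((intervalIntegral.intervalIntegrable_rpow' (r := -(y * q.toReal)) (a := 0) (b := T)
        (by linarith)).comp_sub_left T).symm
      simpa using this
    rw [intervalIntegrable_iff_integrableOn_Ioo_of_le hT.le] at h1
    refine h1.congr_fun (fun t ht => ?_) measurableSet_Ioo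
    have h0 : 0 ≤ T - t := by linarith [ht.2]
    simp only
    rw [Real.norm_of_nonneg (by positivity), ← Real.rpow_mul h0, neg_mul]

/-- Distributes a singularity of order `b` between space (`x`) and time (`y`), with `r` standing for
`1/q`, so that each factor is separately integrable. -/
theorem exists_exponent_split {b p r : ℝ} (hb : 0 ≤ b) (hp : 1 ≤ p) (h : b < 1 / p + r) :
    ∃ x y : ℝ, 0 ≤ x ∧ 0 ≤ y ∧ x + y = b ∧ x * p < 1 ∧ (y = 0 ∨ y < r) := by
  have hp0 : 0 < p := by linarith
  by_cases hbp : b < 1 / p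
  · exact ⟨b, 0, hb, le_rfl, add_zero b, (lt_div_iff₀ hp0).1 hbp, Or.inl rfl⟩
  · push Not at hbp
    obtain ⟨x, h1, h2⟩ := exists_between (show max (b - r) 0 < 1 / p from
      max_lt (by linarith) (by positivity))
    refine ⟨x, b - x, ((le_max_right _ _).trans_lt h1).le, by linarith, by ring,
      (lt_div_iff₀ hp0).1 h2, Or.inr ?_⟩
    linarith [(le_max_left (b - r) 0).trans_lt h1]

/-- A function dominated by a negative power of the parabolic distance to the singular set lies
in `L^q_t L^p_x` in the scale-subcritical range. -/
theorem memLqLp_of_norm_le_rpow {F : Type*} [NormedAddCommGroup F] {T : ℝ} (hT : 0 < T)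
    {g : ℝ → E3 → F} (hg : ContinuousOn (fun z : ℝ × E3 => g z.1 z.2) (Ico 0 T ×ˢ cylD))
    {C b p : ℝ} {q : ℝ≥0∞} (hC : 0 ≤ C) (hb : 0 ≤ b)
    (hbound : ∀ t ∈ Ico 0 T, ∀ x ∈ cylD, ‖g t x‖ ≤ C * (radSq x + (T - t)) ^ (-b))
    (hp : 1 ≤ p) (hq : 1 ≤ q) (h : b < 1 / p + (q⁻¹).toReal) :
    MemLqLp T q (ENNReal.ofReal p) g := by
  refine ⟨?_, ?_⟩
  · rw [Measure.prod_restrict]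
    exact (hg.mono (prod_mono Ioo_subset_Ico_self Subset.rfl)).aestronglyMeasurable
      (measurableSet_Ioo.prod measurableSet_cylD)
  obtain ⟨x₀, y₀, hx, hy, hxy, hxp, hyq⟩ := exists_exponent_split hb hp h
  have hK := memLp_cylD_abs_mul_rpow hp hxp
  set K := eLpNorm (fun x : E3 => |x 0 * x 1| ^ (-x₀)) (ENNReal.ofReal p) (volume.restrict cylD)
    with hKdef
  have hKt : K ≠ ⊤ := hK.2.ne
  have hN : ∀ t ∈ Ioo 0 T, eLpNorm (g t) (ENNReal.ofReal p) (volume.restrict cylD) ≤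
      ENNReal.ofReal (C * (T - t) ^ (-y₀)) * K := by
    intro t ht
    refine eLpNorm_le_mul_eLpNorm_of_ae_le_mul ?_ _
    filter_upwards [ae_restrict_mem measurableSet_cylD, ae_restrict_of_ae (ae_coord_ne_zero 0),
      ae_restrict_of_ae (ae_coord_ne_zero 1)] with x hxD h0 h1
    refine (hbound t ⟨ht.1.le, ht.2⟩ x hxD).trans ?_
    have hτ : 0 < T - t := by linarith [ht.2]
    have hU := radSq_add_pos ht.2 x
    have hm : 0 < |x 0 * x 1| := abs_pos.2 (mul_ne_zero h0 h1)
    -- Since `U` dominates both `|x₀x₁|` and `T - t`, the power `U^(-b)` is at most the product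
    -- `|x₀x₁|^(-x₀) (T-t)^(-y₀)` with separated variables (exponents `x₀`, `y₀` from the
    -- splitting).
    have hle : |x 0 * x 1| ≤ radSq x + (T - t) := by
      refine le_trans ?_ (le_add_of_nonneg_right hτ.le)
      unfold radSq
      rw [abs_le]
      constructor <;> nlinarith [sq_nonneg (x 0 + x 1), sq_nonneg (x 0 - x 1)]
    rw [Real.norm_of_nonneg (by positivity), mul_assoc, ← hxy, neg_add, Real.rpow_add hU,
      mul_comm ((T - t) ^ (-y₀))]
    gcongr ?_ * (?_ * ?_)
    · exact Real.rpow_le_rpow_of_nonpos hm hle (by linarith)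
    · exact Real.rpow_le_rpow_of_nonpos hτ (le_add_of_nonneg_left (radSq_nonneg x)) (by linarith)
  refine lt_of_le_of_lt ?_ (((memLp_time_rpow hT hq hyq).const_mul (C * K.toReal)).2)
  refine eLpNorm_mono_enorm_ae ?_
  filter_upwards [ae_restrict_mem measurableSet_Ioo] with t ht
  refine (hN t ht).trans (le_of_eq ?_)
  have hτ : 0 < T - t := by linarith [ht.2]
  rw [Real.enorm_of_nonneg (by positivity), mul_right_comm,
    ENNReal.ofReal_mul (p := C * (T - t) ^ (-y₀)) (by positivity), ENNReal.ofReal_toReal hKt]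

/-! ### Pointwise bounds by powers of `U = r² + T - t`. -/

section Bounds

variable {T k t : ℝ} {x : E3}

theorem rpow_neg_one_step {u : ℝ} (hu : 0 < u) (e : ℝ) : u ^ e = u * u ^ (e - 1) := by
  rw [Real.rpow_sub_one hu.ne', mul_div_cancel₀ _ hu.ne']

theorem norm_rotGen_le (ht : t < T) : ‖rotGen x‖ ≤ (radSq x + (T - t)) ^ (1 / 2 : ℝ) := by
  rw [norm_rotGen, ← Real.sqrt_eq_rpow]
  exact Real.sqrt_le_sqrt (by linarith)

theorem abs_profile_le (ht : t < T) (hx : x ∈ cylD) :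
    |profile T k t (radSq x)| ≤ (radSq x + (T - t)) ^ (-k) := by
  have hs := radSq_mem_Icc hx
  have hU := radSq_add_pos ht x
  have hY := Real.rpow_pos_of_pos hU (-k)
  rw [profile, abs_of_nonneg (mul_nonneg (by linarith [hs.2]) hY.le)]
  nlinarith [hs.1]

/-- Differentiating in `s` costs one power of `U`, and the factor `r² ≤ U` recovers it; in the
velocity gradient this factor comes from `∇(r²)` and `rotGen x`. -/
theorem radSq_mul_abs_profileD_le (hk : 0 < k) (ht : t < T) (hx : x ∈ cylD) :
    radSq x * |profileD T k t (radSq x)| ≤ (1 + k) * (radSq x + (T - t)) ^ (-k) := by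
  have hs := radSq_mem_Icc hx
  have hU := radSq_add_pos ht x
  have hY := Real.rpow_pos_of_pos hU (-k - 1)
  have h1 : |profileD T k t (radSq x)| ≤
      (radSq x + (T - t) + k) * (radSq x + (T - t)) ^ (-k - 1) := by
    rw [profileD, rpow_neg_one_step hU (-k), abs_le]
    have h2 : 0 ≤ radSq x * (k * (radSq x + (T - t)) ^ (-k - 1)) := by
      have := hs.1; positivity
    have h3 : 0 ≤ (1 - radSq x) * (k * (radSq x + (T - t)) ^ (-k - 1)) :=
      mul_nonneg (by linarith [hs.2]) (by positivity)
    have h4 : 0 < (radSq x + (T - t)) * (radSq x + (T - t)) ^ (-k - 1) := by positivity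
    constructor <;> nlinarith
  rw [rpow_neg_one_step hU (-k)]
  set U := radSq x + (T - t) with hUdef
  have hsU : radSq x ≤ U := by linarith
  calc radSq x * |profileD T k t (radSq x)| ≤ radSq x * ((U + k) * U ^ (-k - 1)) :=
        mul_le_mul_of_nonneg_left h1 hs.1
    _ = (radSq x * U + k * radSq x) * U ^ (-k - 1) := by ring
    _ ≤ (1 * U + k * U) * U ^ (-k - 1) := by
        have := hs.2
        gcongr
    _ = (1 + k) * (U * U ^ (-k - 1)) := by ring

theorem norm_swirlVelocity_le (ht : t < T) (hx : x ∈ cylD) :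
    ‖swirlVelocity T k t x‖ ≤ 1 * (radSq x + (T - t)) ^ (-(k - 1 / 2)) := by
  have hU := radSq_add_pos ht x
  rw [swirlVelocity, norm_smul, Real.norm_eq_abs, one_mul,
    show -(k - 1 / 2) = -k + 1 / 2 by ring, Real.rpow_add hU]
  exact mul_le_mul (abs_profile_le ht hx) (norm_rotGen_le ht) (norm_nonneg _) (by positivity)

theorem norm_pderivD_swirlVelocity_le (hk : 0 < k) (ht : t < T) (hx : x ∈ cylD) (i : Fin 3) :
    ‖pderivD i (swirlVelocity T k t) x‖ ≤ (3 + 2 * k) * (radSq x + (T - t)) ^ (-k) := by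
  have hU := radSq_add_pos ht x
  have h : pderivD i (swirlVelocity T k t) x = _ := pderivD_swirl hx (hasDerivAt_profile hU) i
  have h1 : ‖rotGen (stdVec i)‖ ≤ 1 := by
    rw [norm_rotGen, Real.sqrt_le_left zero_le_one]
    fin_cases i <;> simp [radSq, stdVec]
  have h2 : |horCoord i x| ≤ √(radSq x) := Real.abs_le_sqrt (horCoord_mul_self_le i x)
  have h3 : √(radSq x) * √(radSq x) = radSq x := Real.mul_self_sqrt (radSq_nonneg x)
  have h4 := radSq_mul_abs_profileD_le hk ht hx
  rw [h]
  refine (norm_add_le _ _).trans ?_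
  rw [norm_smul, norm_smul, norm_mul, norm_mul, norm_rotGen]
  simp only [Real.norm_eq_abs, abs_two]
  have e1 : 2 * |horCoord i x| * |profileD T k t (radSq x)| * √(radSq x) ≤
      2 * (radSq x * |profileD T k t (radSq x)|) := by
    calc 2 * |horCoord i x| * |profileD T k t (radSq x)| * √(radSq x)
        ≤ 2 * √(radSq x) * |profileD T k t (radSq x)| * √(radSq x) := by gcongr
      _ = 2 * ((√(radSq x) * √(radSq x)) * |profileD T k t (radSq x)|) := by ring
      _ = _ := by rw [h3]
  have e2 : |profile T k t (radSq x)| * ‖rotGen (stdVec i)‖ ≤ (radSq x + (T - t)) ^ (-k) * 1 :=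
    mul_le_mul (abs_profile_le ht hx) h1 (norm_nonneg _) (by positivity)
  linarith

theorem norm_le_sum_norm_stdVec {F : Type*} [NormedAddCommGroup F] [NormedSpace ℝ F]
    (L : E3 →L[ℝ] F) : ‖L‖ ≤ ∑ i, ‖L (stdVec i)‖ := by
  refine L.opNorm_le_bound (by positivity) fun y => ?_
  conv_lhs => rw [← sum_smul_stdVec y]
  rw [map_sum, Finset.sum_mul]
  refine (norm_sum_le _ _).trans (Finset.sum_le_sum fun i _ => ?_)
  rw [map_smul, norm_smul, mul_comm]
  gcongr
  exact PiLp.norm_apply_le y i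

theorem norm_fderivWithin_swirlVelocity_le (hk : 0 < k) (ht : t < T) (hx : x ∈ cylD) :
    ‖fderivWithin ℝ (swirlVelocity T k t) cylD x‖ ≤
      (3 * (3 + 2 * k)) * (radSq x + (T - t)) ^ (-k) := by
  have h := norm_pderivD_swirlVelocity_le hk ht hx
  refine (norm_le_sum_norm_stdVec _).trans ?_
  refine (Finset.sum_le_sum fun i _ => h i).trans (le_of_eq ?_)
  simp
  ring

theorem norm_swirlForce_le (hk : 0 < k) (ht : t ∈ Ico 0 T) (hx : x ∈ cylD) :
    ‖swirlForce T k t x‖ ≤ (4 * (2 * k + k * (k + 1)) + 8 * (1 + T + k) + k) *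
      (radSq x + (T - t)) ^ (-(k + 1 / 2)) := by
  have hs := radSq_mem_Icc hx
  have hU := radSq_add_pos ht.2 x
  rw [swirlForce, norm_smul, Real.norm_eq_abs,
    show -(k + 1 / 2) = (-k - 1) + 1 / 2 by ring, Real.rpow_add hU, ← mul_assoc]
  refine mul_le_mul ?_ (norm_rotGen_le ht.2) (norm_nonneg _)
    (by have := ht.1.trans_lt ht.2; positivity)
  simp only [profileDD, profileD, profileDt]
  -- All powers are written through `Y = U^(-k-2)`, so the target becomes a multiple of `U * Y =
  -- U^(-k-1)`. The factor `r²` before `profileDD` pays for its extra singularity, and `U ≤ 1 + T`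
  -- absorbs the milder term.
  rw [rpow_neg_one_step hU (-k), rpow_neg_one_step hU (-k - 1),
    show -k - 1 - 1 = -k - 2 by ring]
  set U := radSq x + (T - t) with hUdef
  have hY := Real.rpow_pos_of_pos hU (-k - 2)
  set Y := U ^ (-k - 2)
  obtain ⟨hs0, hs1⟩ := hs
  set s := radSq x
  have hsU : s ≤ U := by linarith [ht.2]
  have hUT : U ≤ 1 + T := by linarith [ht.1]
  have hs1' : 0 ≤ 1 - s := by linarith
  have hUY : 0 < U * Y := by positivity
  have hkUY : 0 < k * (U * Y) := by positivity
  have a1 : 0 ≤ s * (2 * k * (U * Y)) ∧ s * (2 * k * (U * Y)) ≤ 2 * k * (U * Y) :=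
    ⟨by positivity, by nlinarith⟩
  have a2 : 0 ≤ s * ((1 - s) * (k * (k + 1) * Y)) ∧
      s * ((1 - s) * (k * (k + 1) * Y)) ≤ k * (k + 1) * (U * Y) := by
    refine ⟨by positivity, ?_⟩
    calc s * ((1 - s) * (k * (k + 1) * Y)) ≤ U * (1 * (k * (k + 1) * Y)) := by
          gcongr
          linarith
      _ = _ := by ring
  have a3 : 0 ≤ U * (U * Y) ∧ U * (U * Y) ≤ (1 + T) * (U * Y) := ⟨by positivity, by gcongr⟩
  have a4 : 0 ≤ (1 - s) * (k * (U * Y)) ∧ (1 - s) * (k * (U * Y)) ≤ k * (U * Y) :=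
    ⟨by positivity, by nlinarith⟩
  rw [abs_le]
  constructor <;> nlinarith

end Bounds

/-! ### Exponent arithmetic, blow up and conclusion. -/

/-- A form uniform in `q`, including `q = ∞` with `1/q = 0`. Strictness is given up here and
regained from the slack in the choice of `k`. -/
theorem ExponentConstraint.le {c p : ℝ} {q : ℝ≥0∞} (hq : 1 ≤ q)
    (h : ExponentConstraint c p q) : c * p ≤ 2 + 2 * (q⁻¹).toReal := by
  unfold ExponentConstraint at h
  by_cases hqt : q = ⊤
  · subst hqt
    by_contra! hlt
    have hpos : (0 : EReal) < ((c * p - 2 : ℝ) : EReal) := by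
      rw [EReal.coe_pos]
      simp at hlt
      linarith
    rw [EReal.coe_ennreal_top, EReal.mul_top_of_pos hpos] at h
    exact absurd h (by simp)
  · have hq0 : 0 < q.toReal := ENNReal.toReal_pos (by positivity) hqt
    have e : (q : EReal) = ((q.toReal : ℝ) : EReal) :=
      (EReal.coe_ennreal_toReal hqt).symm
    rw [e, ← EReal.coe_mul] at h
    have h2 : (c * p - 2) * q.toReal < 2 := EReal.coe_lt_coe_iff.1 h
    rw [ENNReal.toReal_inv]
    have h3 : c * p - 2 < 2 / q.toReal := (lt_div_iff₀ hq0).2 h2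
    rw [div_eq_mul_inv] at h3
    linarith

theorem enorm_le_eLpNorm_top {F : Type*} [NormedAddCommGroup F] {g : E3 → F}
    (hg : ContinuousOn g cylD) {x : E3} (hx : x ∈ cylD) :
    ‖g x‖ₑ ≤ eLpNorm g ⊤ (volume.restrict cylD) := by
  by_cases hM : eLpNorm g ⊤ (volume.restrict cylD) = ⊤
  · rw [hM]; exact le_top
  set M := eLpNorm g ⊤ (volume.restrict cylD) with hMdef
  -- The inequality `‖g‖ ≤ M` is recast as an equality of continuous functions, which extends from
  -- almost every point to every point.
  have hae : (fun y => max ‖g y‖ M.toReal) =ᵐ[volume.restrict cylD] fun _ => M.toReal := by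
    have h : ∀ᵐ y ∂(volume.restrict cylD), ‖g y‖ₑ ≤ M := by
      rw [hMdef, eLpNorm_exponent_top]
      exact ae_le_eLpNormEssSup
    filter_upwards [h] with y hy
    have := ENNReal.toReal_mono hM hy
    rw [toReal_enorm] at this
    exact max_eq_right this
  have h := Measure.eqOn_of_ae_eq hae (hg.norm.sup continuousOn_const) continuousOn_const
    cylD_subset_closure_interior hx
  have h2 : ‖g x‖ ≤ M.toReal := max_eq_right_iff.1 h
  rw [← ofReal_norm]
  exact ENNReal.ofReal_le_of_le_toReal h2

theorem tendsto_eLpNorm_top_swirlVelocity {T k : ℝ} (hT : 0 < T) (hk : 1 / 2 < k) :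
    Tendsto (fun t => eLpNorm (swirlVelocity T k t) ⊤ (volume.restrict cylD)) (𝓝[<] T) (𝓝 ⊤) := by
  have h1 : Tendsto (fun t : ℝ => T - t) (𝓝[<] T) (𝓝[>] 0) := by
    refine tendsto_nhdsWithin_iff.2 ⟨?_, ?_⟩
    · have : Tendsto (fun t : ℝ => T - t) (𝓝 T) (𝓝 (T - T)) := by
        exact (continuous_const.sub continuous_id).tendsto T
      rw [sub_self] at this
      exact this.mono_left nhdsWithin_le_nhds
    · filter_upwards [self_mem_nhdsWithin] with t ht
      exact sub_pos.2 (mem_Iio.1 ht)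
  -- A lower bound for `|v|` at distance `√(T-t)` from the axis: there `U = 2(T-t)`, giving
  -- `2^(-k)`, and `1 - r² ≥ 1/2` once `T - t < 1/2`.
  have h2 : Tendsto (fun t : ℝ => (1 / 2 * 2 ^ (-k)) * (T - t) ^ (-(k - 1 / 2)))
      (𝓝[<] T) atTop :=
    ((tendsto_rpow_neg_nhdsGT_zero (by linarith)).comp h1).const_mul_atTop (by positivity)
  refine tendsto_nhds_top_mono (ENNReal.tendsto_ofReal_atTop.comp h2) ?_
  filter_upwards [Ioo_mem_nhdsLT (show max 0 (T - 1 / 2) < T from max_lt hT (by linarith))]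
    with t ht
  have ht0 : 0 < t := (le_max_left _ _).trans_lt ht.1
  have hτ : 0 < T - t := by linarith [ht.2]
  have hτ2 : T - t < 1 / 2 := by linarith [(le_max_right 0 (T - 1 / 2)).trans_lt ht.1]
  have hr : radSq (√(T - t) • stdVec 0) = T - t := by
    simp [radSq, stdVec, Real.sq_sqrt hτ.le]
  have hx : √(T - t) • stdVec 0 ∈ cylD := by
    refine ⟨?_, ?_, ?_⟩
    · have : radSq (√(T - t) • stdVec 0) ≤ 1 := by rw [hr]; linarith
      exact this
    · simp [stdVec]
    · simp [stdVec]
  refine le_trans ?_ (enorm_le_eLpNorm_top (contDiffOn_slice (n := 1)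
    (contDiffOn_swirlVelocity T k) ⟨ht0.le, ht.2⟩).continuousOn hx)
  rw [← ofReal_norm]
  refine ENNReal.ofReal_le_ofReal ?_
  simp only
  rw [swirlVelocity, norm_smul, norm_rotGen, hr, profile, Real.sqrt_eq_rpow, ← two_mul,
    Real.mul_rpow two_pos.le hτ.le, Real.norm_of_nonneg (by
      have : 0 ≤ 1 - (T - t) := by linarith
      positivity), show -(k - 1 / 2) = -k + 1 / 2 by ring, Real.rpow_add hτ]
  have e : (1 - (T - t)) * (2 ^ (-k) * (T - t) ^ (-k)) * (T - t) ^ (1 / 2 : ℝ) =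
    (1 - (T - t)) * 2 ^ (-k) * ((T - t) ^ (-k) * (T - t) ^ (1 / 2 : ℝ)) := by ring
  rw [e]
  gcongr
  linarith

theorem corollary1 (T : ℝ) (hT : 0 < T) (α : ℝ) (hα0 : 0 ≤ α) (hα1 : α < 1)
    (p : ℝ) (hp : 1 ≤ p) (q : ℝ≥0∞) (hq : 1 ≤ q)
    (hpq : ExponentConstraint (3 - α) p q) :
    ∃ (f : ℝ → E3 → E3) (v₀ : E3 → E3) (v : ℝ → E3 → E3),
      -- the force: smooth before `T`, and in `L^q_t L^p_x`
      SmoothOnCyl T f ∧ MemLqLp T q (ENNReal.ofReal p) f ∧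
      -- the velocity: smooth before `T`, solves the problem, and is the only classical solution
      SmoothOnCyl T v ∧ (∃ P : ℝ → E3 → ℝ, IsClassicalNSSolution T f v₀ v P) ∧
      (∀ (u : ℝ → E3 → E3) (Q : ℝ → E3 → ℝ), IsClassicalNSSolution T f v₀ u Q →
        ∀ t ∈ Ico 0 T, ∀ x ∈ cylD, u t x = v t x) ∧
      -- the energy class `L^∞_t L^2_x ∩ L^2_t H^1_x`
      MemLqLp T ⊤ 2 v ∧ MemLqLp T 2 2 v ∧
      MemLqLp T 2 2 (fun t x => fderivWithin ℝ (v t) cylD x) ∧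
      -- blow up as `t → T`
      Tendsto (fun t => eLpNorm (v t) ⊤ (volume.restrict cylD)) (𝓝[<] T) (𝓝 ⊤) ∧
      -- and only there
      (∀ t₁ < T, ∃ M : ℝ, ∀ t ∈ Icc 0 t₁, ∀ x ∈ cylD, ‖v t x‖ ≤ M) ∧
      -- integrability of the velocity
      (∀ (p' : ℝ) (q' : ℝ≥0∞), 1 ≤ p' → 1 ≤ q' → ExponentConstraint (1 - α) p' q' →
        MemLqLp T q' (ENNReal.ofReal p') v) := by
  -- Blow up needs `a > 0`, the `L²_t H¹_x` bound needs `a < 1/2`, and the force and velocity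
  -- constraints both allow `a < (1-α)/2`. Half of that last bound satisfies everything.
  obtain ⟨a, ha⟩ : ∃ a, a = (1 - α) / 4 := ⟨_, rfl⟩
  obtain ⟨k, hka⟩ : ∃ k, k = 1 / 2 + a := ⟨_, rfl⟩
  have hk : 1 / 2 < k := by linarith
  have hk1 : k < 1 := by linarith
  have hk0 : 0 < k := by linarith
  have hv1 : ContDiffOn ℝ 1 (fun z : ℝ × E3 => swirlVelocity T k z.1 z.2) (Ico 0 T ×ˢ cylD) :=
    contDiffOn_swirlVelocity T k
  have hvmem : ∀ (p' : ℝ) (q' : ℝ≥0∞), 1 ≤ p' → 1 ≤ q' → k - 1 / 2 < 1 / p' + (q'⁻¹).toReal →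
      MemLqLp T q' (ENNReal.ofReal p') (swirlVelocity T k) := fun p' q' hp' hq' h =>
    memLqLp_of_norm_le_rpow hT hv1.continuousOn zero_le_one (by linarith)
      (fun t ht x hx => norm_swirlVelocity_le ht.2 hx) hp' hq' h
  have hsol := isClassicalNSSolution_swirl (T := T) hk hk1
  refine ⟨swirlForce T k, swirlVelocity T k 0, swirlVelocity T k, contDiffOn_swirlForce T k, ?_,
    contDiffOn_swirlVelocity T k, ⟨_, hsol⟩, fun u Q hu => hu.unique hsol, ?_, ?_, ?_,
    tendsto_eLpNorm_top_swirlVelocity hT hk,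
    fun t₁ ht₁ => exists_bound_of_continuousOn_spaceTime hv1.continuousOn ht₁, ?_⟩
  · refine memLqLp_of_norm_le_rpow hT (contDiffOn_swirlForce (n := 1) T k).continuousOn
      (by positivity) (by linarith) (fun t ht x hx => norm_swirlForce_le hk0 ht hx) hp hq ?_
    have h := hpq.le hq
    have hp0 : 0 < p := by linarith
    -- The constraint gives `1/q ≥ p + 2ap - 1`, so `1/p + 1/q ≥ (p + 1/p) - 1 + 2ap ≥ 1 + 2a > 1 +
    -- a = k + 1/2`.
    have h1 : 2 ≤ p + 1 / p := by
      rw [← sub_nonneg, show p + 1 / p - 2 = (p - 1) ^ 2 / p by field_simp; ring]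
      positivity
    have h2 : a ≤ a * p := by nlinarith
    rw [show (3 - α) = 2 + 4 * a by rw [ha]; ring] at h
    linarith
  · have := hvmem 2 ⊤ (by norm_num) le_top (by simp; linarith)
    simpa using this
  · have := hvmem 2 2 (by norm_num) (by norm_num) (by simp; linarith)
    simpa using this
  · have := memLqLp_of_norm_le_rpow (p := 2) (q := 2) hT (continuousOn_fderivWithin_space hv1)
      (by positivity) hk0.le (fun t ht x hx => norm_fderivWithin_swirlVelocity_le hk0 ht.2 hx)
      (by norm_num) (by norm_num) (by simp; linarith)
    simpa using this
  · intro p' q' hp' hq' hc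
    refine hvmem p' q' hp' hq' ?_
    have h := hc.le hq'
    have hp0 : 0 < p' := by linarith
    have hr : 0 ≤ (q'⁻¹).toReal := ENNReal.toReal_nonneg
    -- The order of `v` is `k - 1/2 = a`, strictly below `2a = (1-α)/2`, and the right side is at
    -- most `1/p' + 1/q'` because `p' ≥ 1`.
    have h1 : (1 - α) / 2 ≤ (1 + (q'⁻¹).toReal) / p' := by
      rw [le_div_iff₀ hp0]; linarith
    have h2 : (q'⁻¹).toReal / p' ≤ (q'⁻¹).toReal := div_le_self hr hp'
    rw [add_div] at h1
    linarith
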